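/- Theorem 3. Let $q$ be a complex number with $|q|<1$ and write $(x;q)_n=\prod_{i=0}^{n-1}(1-xq^i)$, $(x;q)_\infty=\prod_{i=0}^{\infty}(1-xq^i)$ and $(x_1,\dots,x_j;q)_\infty=(x_1;q)_\infty\cdots(x_j;q)_\infty$. Let $a,b$ be non-zero complex numbers with $a^2q^n\ne 1$ and $b^2q^n\neq 1$ for all $n\in\mathbb Z$ (for $q=0$: $a^2\ne1$ and $b^2\ne1$). Let $(\alpha_n(c,k),\beta_n(c,k))_{n\ge0}$ be a WP-Bailey pair, that is, for each $c\in\{\pm a,\pm b,\pm 1/a,\pm 1/b\}$ and all $k\neq1$ in a neighbourhood of $1$, $\alpha_0(c,k)=\beta_0(c,k)=1$ and $$\beta_n(c,k)=\sum_{j=0}^n\frac{(k/c;q)_{n-j}(k;q)_{n+j}}{(q;q)_{n-j}(cq;q)_{n+j}}\,\alpha_j(c,k)\qquad(n\ge 0).$$ Suppose that for each of these eight values of $c$ and all $n\ge1$ the limits $$\alpha_n^*(c)=\lim_{k\to1}\alpha_n(c,k),\qquad \beta_n^*(c)=\lim_{k\to1}\frac{\beta_n(c,k)}{1-k}$$ exist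 (the derived pair at $c$). For $c\in\{a,b,1/a,1/b\}$ put $$f_2(c,q)=\sum_{n=1}^\infty c^{2n}q^n\beta_n^*(c)-\sum_{n=1}^\infty c^{2n}q^n\beta_n^*(-c)+\sum_{n=1}^\infty\frac{(q;q)_{2n-1}}{(qc^2;q)_{2n}}c^{2n}q^n\alpha_n^*(-c)-\sum_{n=1}^\infty\frac{(q;q)_{2n-1}}{(qc^2;q)_{2n}}c^{2n}q^n\alpha_n^*(c),$$ and suppose that each of the four series in each of $f_2(a,q)$, $f_2(b,q)$, $f_2(1/a,q)$, $f_2(1/b,q)$ converges (not necessarily absolutely). Then $$f_2(a,q)-f_2(b,q)-f_2(1/a,q)+f_2(1/b,q)=\frac{2(a-b)(1+ab)}{(1-a^2)(1-b^2)}-2a\,\frac{(b/a,\,qa/b,\,-ab,\,-q/(ab);q)_\infty\,(q^2,q^2;q^2)_\infty}{(a^2,\,q^2/a^2,\,b^2,\,q^2/b^2;q^2)_\infty}.$$ In particular, the value of the left side does not depend on the WP-Bailey pair. -/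

import Mathlib

open Filter Topology

/-- The finite `q`-shifted factorial `(x; q)_n = (1 - x)(1 - x q) ⋯ (1 - x q ^ (n - 1))`. -/
noncomputable def qPoch (x q : ℂ) (n : ℕ) : ℂ :=
  ∏ i ∈ Finset.range n, (1 - x * q ^ i)

/-- The infinite `q`-shifted factorial `(x; q)_∞ = (1 - x)(1 - x q)(1 - x q ^ 2) ⋯`
(the product converges for `‖q‖ < 1`). -/
noncomputable def qPochInf (x q : ℂ) : ℂ :=
  ∏' i : ℕ, (1 - x * q ^ i)

/-- The sequences `α n = α_n(a, k, q)` and `β n = β_n(a, k, q)` form a WP-Bailey pair at the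
parameters `a`, `k` and base `q`. -/
def IsWPBaileyPair (q a k : ℂ) (α β : ℕ → ℂ) : Prop :=
  α 0 = 1 ∧ β 0 = 1 ∧
    ∀ n : ℕ, β n = ∑ j ∈ Finset.range (n + 1),
      qPoch (k / a) q (n - j) * qPoch k q (n + j) /
        (qPoch q q (n - j) * qPoch (a * q) q (n + j)) * α j

/-- `αs n`, `βs n` (for `n ≥ 1`) is the derived pair at `a` of the family
`α a k n = α_n(a, k)`, `β a k n = β_n(a, k)`: the limits of `α_n(a, k)` and of
`β_n(a, k) / (1 - k)` as `k → 1` exist, and they are `αs n` and `βs n`. -/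
def IsDerivedPair (α β : ℂ → ℂ → ℕ → ℂ) (a : ℂ) (αs βs : ℕ → ℂ) : Prop :=
  ∀ n : ℕ, 1 ≤ n →
    Tendsto (fun k : ℂ => α a k n) (𝓝[≠] 1) (𝓝 (αs n)) ∧
    Tendsto (fun k : ℂ => β a k n / (1 - k)) (𝓝[≠] 1) (𝓝 (βs n))

/-- The series `∑_{n ≥ 1} u n` converges, in the sense that its partial sums have a limit. -/
def SeriesConverges (u : ℕ → ℂ) : Prop :=
  Summable (fun n : ℕ => u (n + 1)) (SummationFilter.conditional ℕ)

/-- The sum `∑_{n ≥ 1} u n`, as a limit of partial sums. -/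
noncomputable def seriesSum (u : ℕ → ℂ) : ℂ :=
  ∑'[SummationFilter.conditional ℕ] n : ℕ, u (n + 1)

/-- The term `a ^ (2 n) q ^ n β*_n(c)`. -/
noncomputable def betaTerm (βs : ℂ → ℕ → ℂ) (q a c : ℂ) (n : ℕ) : ℂ :=
  a ^ (2 * n) * q ^ n * βs c n

/-- The term `(q; q)_{2n-1} / (q a ^ 2; q)_{2n} a ^ (2 n) q ^ n α*_n(c)`, for `n ≥ 1`. -/
noncomputable def alphaTerm (αs : ℂ → ℕ → ℂ) (q a c : ℂ) (n : ℕ) : ℂ :=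
  qPoch q q (2 * n - 1) / qPoch (q * a ^ 2) q (2 * n) * a ^ (2 * n) * q ^ n * αs c n

/-- Each of the four series that make up `f₂(a, q)` converges. -/
def F2Converges (αs βs : ℂ → ℕ → ℂ) (a q : ℂ) : Prop :=
  SeriesConverges (betaTerm βs q a a) ∧ SeriesConverges (betaTerm βs q a (-a)) ∧
    SeriesConverges (alphaTerm αs q a (-a)) ∧ SeriesConverges (alphaTerm αs q a a)

/-- The function `f₂(a, q)` attached to the derived pairs `αs c n = α*_n(c)`,
`βs c n = β*_n(c)`. -/
noncomputable def f2 (αs βs : ℂ → ℕ → ℂ) (a q : ℂ) : ℂ :=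
  seriesSum (betaTerm βs q a a) - seriesSum (betaTerm βs q a (-a))
    + seriesSum (alphaTerm αs q a (-a)) - seriesSum (alphaTerm αs q a a)

/-!
Everything rests on the evaluation `f2_eq`: for any derived pair, `f₂(a) = -2 L(a)` with the
Lambert-type series `L(a) = ∑_{n ≥ 1} a q ^ n / (1 - a ^ 2 q ^ (2 n))` (`oddLambert`). The left side
of the theorem is then a difference of two bilateral Lambert series, and that difference is a
theta quotient (`lambert_sub_eq_theta`).

**Evaluation of `f₂`.** Dividing the relation of the WP-Bailey pairs by `1 - k` and letting `k → 1`
expresses `β*_n(c)` through the `α*_j(c)` by a triangular system (`derived_beta_eq`). If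
`|q c ^ 2| < 1` and everything converges absolutely, summing over `n` first is the `q`-Gauss sum.
Since only conditional convergence is assumed and `|q c ^ 2|` is arbitrary, generating functions in
a variable `x` are used instead. By the `q`-binomial theorem (`tsum_qBinomial`), the coefficients
`(q; q)_{m-1} / (A; q)_m` are sums of powers `q ^ (i m)` (`hasSum_qRatio_mul_pow`), so for small `x`
the generating function of the `β`-side is a sum over `i` of products of a meromorphic factor and
the generating function of `c ^ (2 j) q ^ j α*_j` at `x q ^ (2 i)` (`tsum_kernel_convolution`).
Multiplying by `(q c ^ 2 x; q)_∞` clears the poles, and the identity continues analytically to the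
whole unit disc (`tsum_beta_series`). Letting `x → 1` from the left, by Abel's theorem, gives
`∑ β-terms - ∑ α-terms = ∑_i (l_i - k_i)`, where `l_i` depends on `c ^ 2` only and
`k_i = (q ^ (i + 1); q)_∞ / (c q ^ (i + 1); q)_∞` (`hasSum_beta_sub_alpha`). In the difference of
the values at `c = a` and `c = -a` the `l_i` cancel, and the sums over the `k_i` are Lambert series
by a telescoping argument (`hasSum_qRatio_sub_qRatio_zero`).

**The theta quotient.** In the variables `s = a - 1 / a` and `t = b - 1 / b`, the quotient is a
product over `j ∈ ℤ` of `(s - σ_j) / (s - e_j)` with `σ_j = b q ^ j - 1 / (b q ^ j)` and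
`e_j = q ^ j - q ^ (-j)`. It vanishes at `s = σ_0 = t`. Lagrange interpolation expands the truncation
to `|j| ≤ N` in partial fractions (`prod_sub_div_eq_sum`). Its residues are
`-t (q ^ i + q ^ (-i)) / 2` times partial products of one and the same convergent product
`∏ (1 + t / e_m)` over the integers `m ≠ 0` (`residue_eq`). So dominated convergence applies as
`N → ∞` (`tendsto_truncated_theta`), and the resulting sum over `i ∈ ℤ` is the difference of the
bilateral Lambert series (`tsum_polarTerm`). For `q = 0` the identity is elementary.
-/

/-! ### Infinite `q`-shifted factorials -/

section QPochhammer

variable {q : ℂ}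

lemma qPoch_zero (x q : ℂ) : qPoch x q 0 = 1 := by simp [qPoch]

lemma qPoch_succ (x q : ℂ) (n : ℕ) : qPoch x q (n + 1) = qPoch x q n * (1 - x * q ^ n) := by
  simp [qPoch, Finset.prod_range_succ]

lemma qPoch_succ' (x q : ℂ) (n : ℕ) : qPoch x q (n + 1) = (1 - x) * qPoch (x * q) q n := by
  simp only [qPoch, Finset.prod_range_succ', pow_zero, mul_one]
  rw [mul_comm]
  congr 1
  refine Finset.prod_congr rfl fun i _ => ?_
  ring

lemma qPoch_ne_zero {x : ℂ} (hx : ∀ n : ℕ, x * q ^ n ≠ 1) (n : ℕ) : qPoch x q n ≠ 0 :=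
  Finset.prod_ne_zero_iff.2 fun i _ => sub_ne_zero.2 (hx i).symm

lemma continuous_qPoch (q : ℂ) (n : ℕ) : Continuous fun x => qPoch x q n := by
  unfold qPoch
  fun_prop

lemma differentiable_qPoch (q : ℂ) (n : ℕ) : Differentiable ℂ fun x => qPoch x q n := by
  unfold qPoch
  fun_prop

lemma summable_norm_mul_pow (hq : ‖q‖ < 1) (x : ℂ) : Summable fun i : ℕ => ‖-(x * q ^ i)‖ := by
  simpa [norm_mul, norm_pow] using
    (summable_geometric_of_lt_one (norm_nonneg q) hq).mul_left ‖x‖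

lemma tendsto_qPoch (hq : ‖q‖ < 1) (x : ℂ) :
    Tendsto (fun n => qPoch x q n) atTop (𝓝 (qPochInf x q)) := by
  have h := (multipliable_one_add_of_summable
    (summable_norm_mul_pow hq x)).hasProd.tendsto_prod_nat
  simp only [← sub_eq_add_neg] at h
  exact h

lemma qPochInf_zero (q : ℂ) : qPochInf 0 q = 1 := by simp [qPochInf]

lemma qPochInf_ne_zero (hq : ‖q‖ < 1) {x : ℂ} (hx : ∀ n : ℕ, x * q ^ n ≠ 1) :
    qPochInf x q ≠ 0 := by
  have h := tprod_one_add_ne_zero_of_summable (f := fun i : ℕ => -(x * q ^ i))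
    (fun i => by rw [← sub_eq_add_neg]; exact sub_ne_zero.2 (hx i).symm)
    (summable_norm_mul_pow hq x)
  simp only [← sub_eq_add_neg] at h
  exact h

lemma qPoch_mul_shift (x q : ℂ) (m n : ℕ) :
    qPoch x q (m + n) = qPoch x q m * qPoch (x * q ^ m) q n := by
  simp only [qPoch, Finset.prod_range_add]
  congr 1
  refine Finset.prod_congr rfl fun i _ => ?_
  ring

lemma qPochInf_eq_mul_shift (hq : ‖q‖ < 1) (x : ℂ) (m : ℕ) :
    qPochInf x q = qPoch x q m * qPochInf (x * q ^ m) q := by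
  have h1 := (tendsto_qPoch hq x).comp (tendsto_add_atTop_nat m)
  have h2 := (tendsto_qPoch hq (x * q ^ m)).const_mul (qPoch x q m)
  refine tendsto_nhds_unique h1 (h2.congr fun n => ?_)
  rw [Function.comp_apply, add_comm, qPoch_mul_shift]

lemma qPochInf_eq_one_sub_mul (hq : ‖q‖ < 1) (x : ℂ) :
    qPochInf x q = (1 - x) * qPochInf (x * q) q := by
  simpa [qPoch] using qPochInf_eq_mul_shift hq x 1

lemma norm_qPoch_sub_one_le (hq : ‖q‖ < 1) (x : ℂ) (n : ℕ) :
    ‖qPoch x q n - 1‖ ≤ Real.exp (‖x‖ / (1 - ‖q‖)) - 1 := by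
  have h := Finset.norm_prod_one_add_sub_one_le (Finset.range n) (fun i => -(x * q ^ i))
  simp only [← sub_eq_add_neg] at h
  refine h.trans (sub_le_sub_right (Real.exp_le_exp.2 ?_) _)
  refine ((summable_norm_mul_pow hq x).sum_le_tsum _ fun _ _ => norm_nonneg _).trans (le_of_eq ?_)
  simp only [norm_neg, norm_mul, norm_pow]
  rw [tsum_mul_left, tsum_geometric_of_lt_one (norm_nonneg q) hq, div_eq_mul_inv]

lemma norm_qPochInf_sub_one_le (hq : ‖q‖ < 1) (x : ℂ) :
    ‖qPochInf x q - 1‖ ≤ Real.exp (‖x‖ / (1 - ‖q‖)) - 1 :=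
  le_of_tendsto ((tendsto_qPoch hq x).sub_const 1).norm
    (Eventually.of_forall fun n => norm_qPoch_sub_one_le hq x n)

/-- On bounded sets, `(x; q)_n = 1 + O(x)` uniformly in `n`. -/
lemma exists_norm_qPoch_sub_one_le (hq : ‖q‖ < 1) (R : ℝ) :
    ∃ C : ℝ, 0 ≤ C ∧ ∀ x : ℂ, ‖x‖ ≤ R → (∀ n, ‖qPoch x q n - 1‖ ≤ C * ‖x‖) ∧
      ‖qPochInf x q - 1‖ ≤ C * ‖x‖ := by
  have hq' : 0 < 1 - ‖q‖ := sub_pos.2 hq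
  refine ⟨Real.exp (R / (1 - ‖q‖)) / (1 - ‖q‖), by positivity, fun x hx => ?_⟩
  have key : Real.exp (‖x‖ / (1 - ‖q‖)) - 1 ≤
      Real.exp (R / (1 - ‖q‖)) / (1 - ‖q‖) * ‖x‖ := by
    have h1 : Real.exp (‖x‖ / (1 - ‖q‖)) ≤ Real.exp (R / (1 - ‖q‖)) :=
      Real.exp_le_exp.2 (by gcongr)
    have h2 := Real.add_one_le_exp (-(‖x‖ / (1 - ‖q‖)))
    rw [Real.exp_neg] at h2
    have h3 : 0 < Real.exp (‖x‖ / (1 - ‖q‖)) := Real.exp_pos _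
    -- `exp s - 1 ≤ s * exp s`, from `1 - s ≤ exp (-s)`
    have h4 : Real.exp (‖x‖ / (1 - ‖q‖)) - 1 ≤
        ‖x‖ / (1 - ‖q‖) * Real.exp (‖x‖ / (1 - ‖q‖)) := by
      have := mul_le_mul_of_nonneg_right h2 h3.le
      rw [inv_mul_cancel₀ h3.ne'] at this
      linarith
    refine h4.trans ((mul_le_mul_of_nonneg_left h1 (by positivity)).trans (le_of_eq ?_))
    ring
  exact ⟨fun n => (norm_qPoch_sub_one_le hq x n).trans key,
    (norm_qPochInf_sub_one_le hq x).trans key⟩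

lemma differentiable_qPochInf (hq : ‖q‖ < 1) : Differentiable ℂ fun x => qPochInf x q := by
  intro x
  have hs : Summable fun i : ℕ => (‖x‖ + 1) * ‖q‖ ^ i :=
    (summable_geometric_of_lt_one (norm_nonneg q) hq).mul_left _
  have hball : Metric.ball (0 : ℂ) (‖x‖ + 1) ∈ 𝓝 x :=
    Metric.isOpen_ball.mem_nhds (by simp)
  have h := hs.hasProdLocallyUniformlyOn_nat_one_add (f := fun i y => -(y * q ^ i))
    (K := Metric.ball (0 : ℂ) (‖x‖ + 1)) Metric.isOpen_ball
    (Eventually.of_forall fun n y hy => by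
      rw [norm_neg, norm_mul, norm_pow]
      gcongr
      exact (mem_ball_zero_iff.1 hy).le) (fun n => by fun_prop)
  have hd := h.differentiableOn (Eventually.of_forall fun s => by
    simpa [Finset.prod_fn] using DifferentiableOn.finsetProd (fun _ _ => by fun_prop))
    Metric.isOpen_ball
  have hx := hd.differentiableAt hball
  simp only [← sub_eq_add_neg] at hx
  exact hx

lemma continuous_qPochInf (hq : ‖q‖ < 1) : Continuous fun x => qPochInf x q :=
  (differentiable_qPochInf hq).continuous

lemma tendsto_mul_pow_zero (hq : ‖q‖ < 1) (x : ℂ) :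
    Tendsto (fun n : ℕ => x * q ^ n) atTop (𝓝 0) := by
  simpa using (tendsto_pow_atTop_nhds_zero_of_norm_lt_one hq).const_mul x

lemma tendsto_qPochInf_mul_pow (hq : ‖q‖ < 1) (x : ℂ) :
    Tendsto (fun n : ℕ => qPochInf (x * q ^ n) q) atTop (𝓝 1) := by
  have := ((continuous_qPochInf hq).tendsto 0).comp (tendsto_mul_pow_zero hq x)
  rwa [qPochInf_zero] at this

/-! ### The `q`-binomial theorem -/

lemma self_mul_pow_ne_one (hq : ‖q‖ < 1) (n : ℕ) : q * q ^ n ≠ 1 := by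
  intro h
  have h' : ‖q * q ^ n‖ = 1 := by rw [h, norm_one]
  rw [norm_mul, norm_pow] at h'
  have := mul_le_of_le_one_right (norm_nonneg q) (pow_le_one₀ (norm_nonneg q) hq.le (n := n))
  linarith

lemma exists_norm_inv_le {v : ℕ → ℂ} {l : ℂ} (hv : Tendsto v atTop (𝓝 l)) (hl : l ≠ 0) :
    ∃ C : ℝ, ∀ n, ‖(v n)⁻¹‖ ≤ C := by
  obtain ⟨C, hC⟩ := ((hv.inv₀ hl).norm).bddAbove_range
  exact ⟨C, fun n => hC ⟨n, rfl⟩⟩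

lemma exists_norm_le_of_tendsto {v : ℕ → ℂ} {l : ℂ} (hv : Tendsto v atTop (𝓝 l)) :
    ∃ C : ℝ, ∀ n, ‖v n‖ ≤ C := by
  obtain ⟨C, hC⟩ := hv.norm.bddAbove_range
  exact ⟨C, fun n => hC ⟨n, rfl⟩⟩

lemma exists_norm_qPoch_div_le (hq : ‖q‖ < 1) (A : ℂ) :
    ∃ C : ℝ, ∀ n, ‖qPoch A q n / qPoch q q n‖ ≤ C :=
  exists_norm_le_of_tendsto ((tendsto_qPoch hq A).div (tendsto_qPoch hq q)
    (qPochInf_ne_zero hq (self_mul_pow_ne_one hq)))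

lemma summable_norm_qBinomial (hq : ‖q‖ < 1) (A : ℂ) {y : ℂ} (hy : ‖y‖ < 1) :
    Summable fun n : ℕ => ‖qPoch A q n / qPoch q q n * y ^ n‖ := by
  obtain ⟨C, hC⟩ := exists_norm_qPoch_div_le hq A
  refine Summable.of_nonneg_of_le (fun _ => norm_nonneg _) (fun n => ?_)
    ((summable_geometric_of_lt_one (norm_nonneg y) hy).mul_left C)
  rw [norm_mul, norm_pow]
  gcongr
  exact hC n

/-- The `q`-binomial theorem. -/
theorem tsum_qBinomial (hq : ‖q‖ < 1) (A : ℂ) {y : ℂ} (hy : ‖y‖ < 1) :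
    ∑' n : ℕ, qPoch A q n / qPoch q q n * y ^ n = qPochInf (A * y) q / qPochInf y q := by
  set F : ℂ → ℂ := fun y => ∑' n : ℕ, qPoch A q n / qPoch q q n * y ^ n with hF
  have hsum : ∀ {y : ℂ}, ‖y‖ < 1 → Summable fun n : ℕ => qPoch A q n / qPoch q q n * y ^ n :=
    fun hy => (summable_norm_qBinomial hq A hy).of_norm
  have hmul : ∀ {y : ℂ}, ‖y‖ < 1 → ∀ n : ℕ, ‖y * q ^ n‖ < 1 := fun {y} hy n => by
    rw [norm_mul, norm_pow]
    exact (mul_le_of_le_one_right (norm_nonneg y) (pow_le_one₀ (norm_nonneg q) hq.le)).trans_lt hy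
  -- the functional equation `(1 - y) F(y) = (1 - A y) F(q y)`
  have hfe : ∀ {y : ℂ}, ‖y‖ < 1 → (1 - y) * F y = (1 - A * y) * F (y * q) := by
    intro y hy
    have hyq : ‖y * q‖ < 1 := by simpa using hmul hy 1
    have s1 := hsum hy
    have s2 := hsum hyq
    have e1 := s1.tsum_eq_zero_add
    have e2 := s2.tsum_eq_zero_add
    have t1 := (summable_nat_add_iff 1).2 s1
    have t2 := (summable_nat_add_iff 1).2 s2
    have key : ∑' n : ℕ, (qPoch A q (n + 1) / qPoch q q (n + 1) * y ^ (n + 1) -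
          y * (qPoch A q n / qPoch q q n * y ^ n)) =
        ∑' n : ℕ, (qPoch A q (n + 1) / qPoch q q (n + 1) * (y * q) ^ (n + 1) -
          A * y * (qPoch A q n / qPoch q q n * (y * q) ^ n)) := by
      refine tsum_congr fun n => ?_
      have h1 := qPoch_ne_zero (self_mul_pow_ne_one hq) n
      have h2 : 1 - q * q ^ n ≠ 0 := sub_ne_zero.2 (self_mul_pow_ne_one hq n).symm
      rw [qPoch_succ, qPoch_succ, mul_pow, mul_pow, pow_succ q, mul_comm (q ^ n) q]
      generalize q ^ n = u at h2 ⊢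
      rw [mul_comm q u] at h2 ⊢
      field_simp
      ring
    rw [t1.tsum_sub (s1.mul_left y), t2.tsum_sub (s2.mul_left (A * y)), tsum_mul_left,
      tsum_mul_left] at key
    simp only [hF]
    simp only [qPoch_zero, pow_zero, div_one, mul_one] at e1 e2
    linear_combination key + e1 - e2
  have hiter : ∀ n : ℕ, qPoch y q n * F y = qPoch (A * y) q n * F (y * q ^ n) := by
    intro n
    induction n with
    | zero => simp [qPoch_zero]
    | succ n ih =>
      have h := hfe (hmul hy n)
      rw [qPoch_succ, qPoch_succ, pow_succ, ← mul_assoc]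
      linear_combination (1 - y * q ^ n) * ih + qPoch (A * y) q n * h
  have hcont : Tendsto (fun n : ℕ => F (y * q ^ n)) atTop (𝓝 1) := by
    have h0 : (∑' n : ℕ, qPoch A q n / qPoch q q n * (0 : ℂ) ^ n) = 1 := by
      rw [tsum_eq_single 0 (fun n hn => by simp [hn])]
      simp [qPoch_zero]
    rw [← h0]
    refine tendsto_tsum_of_dominated_convergence (summable_norm_qBinomial hq A hy)
      (fun k => ((tendsto_mul_pow_zero hq y).pow k).const_mul _)
      (Eventually.of_forall fun n k => ?_)
    rw [norm_mul, norm_mul, norm_pow, norm_pow, norm_mul, norm_pow]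
    gcongr
    exact mul_le_of_le_one_right (norm_nonneg y) (pow_le_one₀ (norm_nonneg q) hq.le)
  have hlim := tendsto_nhds_unique ((tendsto_qPoch hq y).mul_const (F y))
    (((tendsto_qPoch hq (A * y)).mul hcont).congr fun n => (hiter n).symm)
  have hne : qPochInf y q ≠ 0 := qPochInf_ne_zero hq fun n h => by
    have := hmul hy n
    rw [h, norm_one] at this
    exact lt_irrefl _ this
  rw [eq_div_iff hne, mul_comm, hlim, mul_one]

end QPochhammer

/-! ### Kernel expansions and power series with bounded coefficients -/

section Kernel

variable {q : ℂ}

/-- The ratio `(q ^ (i + 1); q)_∞ / (A q ^ i; q)_∞`. These are the coefficients in the expansion of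
`(q; q)_{m-1} / (A; q)_m` in powers of `q ^ m`. -/
noncomputable def qRatio (q A : ℂ) (i : ℕ) : ℂ :=
  qPochInf (q * q ^ i) q / qPochInf (A * q ^ i) q

lemma mul_pow_shift_ne_one {A : ℂ} (hA : ∀ n : ℕ, A * q ^ n ≠ 1) (i n : ℕ) :
    A * q ^ i * q ^ n ≠ 1 := by
  rw [mul_assoc, ← pow_add]
  exact hA _

lemma qRatio_eq (hq : ‖q‖ < 1) {A : ℂ} (hA : ∀ n : ℕ, A * q ^ n ≠ 1) (i : ℕ) :
    qRatio q A i = qPochInf q q / qPochInf A q * (qPoch A q i / qPoch q q i) := by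
  have h1 := qPochInf_ne_zero hq (mul_pow_shift_ne_one hA i)
  have h2 := qPoch_ne_zero hA i
  have h3 := qPoch_ne_zero (self_mul_pow_ne_one hq) i
  rw [qRatio, qPochInf_eq_mul_shift hq q i, qPochInf_eq_mul_shift hq A i]
  field_simp

lemma tendsto_qRatio (hq : ‖q‖ < 1) (A : ℂ) : Tendsto (qRatio q A) atTop (𝓝 1) := by
  have h := (tendsto_qPochInf_mul_pow hq q).div (tendsto_qPochInf_mul_pow hq A) one_ne_zero
  rw [div_one] at h
  exact h

lemma norm_self_pow_lt_one (hq : ‖q‖ < 1) (m : ℕ) : ‖q ^ (m + 1)‖ < 1 := by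
  rw [norm_pow]
  exact pow_lt_one₀ (norm_nonneg q) hq (Nat.succ_ne_zero m)

/-- Expansion of `(q; q)_m / (A; q)_{m+1}` in powers of `q ^ (m + 1)`, an instance of the
`q`-binomial theorem. -/
lemma hasSum_qRatio_mul_pow (hq : ‖q‖ < 1) {A : ℂ} (hA : ∀ n : ℕ, A * q ^ n ≠ 1) (m : ℕ) :
    HasSum (fun i => qRatio q A i * (q ^ (m + 1)) ^ i)
      (qPoch q q m / qPoch A q (m + 1)) := by
  have hm := norm_self_pow_lt_one hq m
  have h := (summable_norm_qBinomial hq A hm).of_norm.hasSum.mul_left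
    (qPochInf q q / qPochInf A q)
  rw [tsum_qBinomial hq A hm] at h
  have e1 : (fun i => qRatio q A i * (q ^ (m + 1)) ^ i) = fun i =>
      qPochInf q q / qPochInf A q * (qPoch A q i / qPoch q q i * (q ^ (m + 1)) ^ i) :=
    funext fun i => by rw [qRatio_eq hq hA, mul_assoc]
  have e2 : qPoch q q m / qPoch A q (m + 1) = qPochInf q q / qPochInf A q *
      (qPochInf (A * q ^ (m + 1)) q / qPochInf (q ^ (m + 1)) q) := by
    have h1 := qPochInf_ne_zero hq (mul_pow_shift_ne_one hA (m + 1))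
    have h2 := qPoch_ne_zero hA (m + 1)
    have h3 := qPochInf_ne_zero hq (mul_pow_shift_ne_one (self_mul_pow_ne_one hq) m)
    rw [← pow_succ'] at h3
    rw [qPochInf_eq_mul_shift hq q m, qPochInf_eq_mul_shift hq A (m + 1), ← pow_succ']
    generalize qPochInf (A * q ^ (m + 1)) q = P at h1 ⊢
    field_simp
  rwa [e1, e2]

lemma norm_scaled_convolution_le (p v : ℕ → ℂ) (x : ℂ) {y : ℂ} (hy : ‖y‖ ≤ 1) (n : ℕ) :
    ‖∑ j ∈ Finset.range (n + 1 + 1),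
        v j * (x * y ^ 2) ^ j * (p (n + 1 - j) * (x * y) ^ (n + 1 - j))‖ ≤
      ‖y‖ * ∑ j ∈ Finset.range (n + 1 + 1), ‖v j * x ^ j‖ * ‖p (n + 1 - j) * x ^ (n + 1 - j)‖ := by
  rw [Finset.mul_sum]
  refine norm_sum_le_of_le _ fun j hj => ?_
  have hj' : j ≤ n + 1 := Nat.lt_succ_iff.1 (Finset.mem_range.1 hj)
  have hexp : v j * (x * y ^ 2) ^ j * (p (n + 1 - j) * (x * y) ^ (n + 1 - j)) =
      y * y ^ (n + j) * ((v j * x ^ j) * (p (n + 1 - j) * x ^ (n + 1 - j))) := by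
    have : y * y ^ (n + j) = (y ^ 2) ^ j * y ^ (n + 1 - j) := by
      rw [← pow_mul y, ← pow_succ', ← pow_add]
      congr 1
      omega
    rw [this, mul_pow, mul_pow]
    ring
  rw [hexp, norm_mul, norm_mul y, norm_mul (v j * x ^ j), norm_pow]
  refine mul_le_mul_of_nonneg_right ?_ (by positivity)
  exact mul_le_of_le_one_right (norm_nonneg y) (pow_le_one₀ (norm_nonneg y) hy)

lemma kernel_convolution_eq_tsum (hq : ‖q‖ < 1) {A : ℂ} (hA : ∀ n : ℕ, A * q ^ n ≠ 1)
    (p v : ℕ → ℂ) (x : ℂ) (n : ℕ) :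
    (∑ j ∈ Finset.range (n + 2),
      p (n + 1 - j) * (qPoch q q (n + j) / qPoch A q (n + 1 + j)) * v j) * x ^ (n + 1) =
      ∑' i : ℕ, qRatio q A i * ∑ j ∈ Finset.range (n + 1 + 1),
        v j * (x * (q ^ i) ^ 2) ^ j * (p (n + 1 - j) * (x * q ^ i) ^ (n + 1 - j)) := by
  have hs : HasSum (fun i => ∑ j ∈ Finset.range (n + 2), p (n + 1 - j) *
      (qRatio q A i * (q ^ (n + j + 1)) ^ i) * v j * x ^ (n + 1))
      (∑ j ∈ Finset.range (n + 2),
        p (n + 1 - j) * (qPoch q q (n + j) / qPoch A q (n + j + 1)) * v j * x ^ (n + 1)) :=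
    hasSum_sum fun j _ =>
      (((hasSum_qRatio_mul_pow hq hA (n + j)).mul_left _).mul_right _).mul_right _
  rw [Finset.sum_mul]
  simp only [add_right_comm n 1]
  rw [← hs.tsum_eq]
  refine tsum_congr fun i => ?_
  rw [Finset.mul_sum]
  refine Finset.sum_congr rfl fun j hj => ?_
  have hj' : j ≤ n + 1 := Nat.lt_succ_iff.1 (Finset.mem_range.1 hj)
  have h1 : (q ^ (n + j + 1)) ^ i = ((q ^ i) ^ 2) ^ j * (q ^ i) ^ (n + 1 - j) := by
    rw [← pow_mul (q ^ i), ← pow_add, ← pow_mul, ← pow_mul]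
    congr 1
    rw [mul_comm i]
    congr 1
    omega
  have h2 : x ^ (n + 1) = x ^ j * x ^ (n + 1 - j) := by
    rw [← pow_add]
    congr 1
    omega
  rw [h1, h2, mul_pow, mul_pow]
  ring

/-- Expanding the factor `(q; q)_{n+j-1} / (A; q)_{n+j}` in a convolution turns the generating
function of the convolution into a sum of products of generating functions at `x q ^ i` and
`x q ^ (2 i)`. -/
lemma tsum_kernel_convolution (hq : ‖q‖ < 1) {A : ℂ} (hA : ∀ n : ℕ, A * q ^ n ≠ 1)
    (p v : ℕ → ℂ) (x : ℂ) (hp : Summable fun m => ‖p m * x ^ m‖)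
    (hv : Summable fun m => ‖v m * x ^ m‖) :
    ∑' n : ℕ, (∑ j ∈ Finset.range (n + 2),
        p (n + 1 - j) * (qPoch q q (n + j) / qPoch A q (n + 1 + j)) * v j) * x ^ (n + 1) =
      ∑' i : ℕ, qRatio q A i * ((∑' m, p m * (x * q ^ i) ^ m) *
        (∑' j, v j * (x * (q ^ i) ^ 2) ^ j) - p 0 * v 0) := by
  obtain ⟨C, hC⟩ := exists_norm_le_of_tendsto (tendsto_qRatio hq A)
  have hC0 : 0 ≤ C := (norm_nonneg _).trans (hC 0)
  have hqi : ∀ i : ℕ, ‖q ^ i‖ ≤ 1 := fun i => by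
    rw [norm_pow]; exact pow_le_one₀ (norm_nonneg q) hq.le
  have hpi : ∀ i, Summable fun m => ‖p m * (x * q ^ i) ^ m‖ := fun i =>
    hp.of_nonneg_of_le (fun _ => norm_nonneg _) fun m => by
      rw [norm_mul, norm_mul, norm_pow, norm_pow, norm_mul]
      gcongr
      exact mul_le_of_le_one_right (norm_nonneg x) (hqi i)
  have hvi : ∀ i, Summable fun m => ‖v m * (x * (q ^ i) ^ 2) ^ m‖ := fun i =>
    hv.of_nonneg_of_le (fun _ => norm_nonneg _) fun m => by
      rw [norm_mul, norm_mul, norm_pow, norm_pow, norm_mul, ← pow_mul]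
      gcongr
      exact mul_le_of_le_one_right (norm_nonneg x) (hqi _)
  have hdsum : Summable fun n => ∑ j ∈ Finset.range (n + 1),
      ‖v j * x ^ j‖ * ‖p (n - j) * x ^ (n - j)‖ := by
    have := summable_norm_sum_mul_range_of_summable_norm
      (f := fun m => ‖v m * x ^ m‖) (g := fun m => ‖p m * x ^ m‖) (by simpa using hv)
      (by simpa using hp)
    exact this.of_norm
  have hb1 : Summable fun i : ℕ => C * ‖q‖ ^ i :=
    (summable_geometric_of_lt_one (norm_nonneg q) hq).mul_left C
  have hb2 := (summable_nat_add_iff 1).2 hdsum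
  have hb := Summable.mul_of_nonneg hb1 hb2
    (fun i => mul_nonneg hC0 (pow_nonneg (norm_nonneg q) i))
    fun n => Finset.sum_nonneg fun _ _ => by positivity
  have hF : Summable fun t : ℕ × ℕ => qRatio q A t.1 * ∑ j ∈ Finset.range (t.2 + 1 + 1),
      v j * (x * (q ^ t.1) ^ 2) ^ j * (p (t.2 + 1 - j) * (x * q ^ t.1) ^ (t.2 + 1 - j)) := by
    refine Summable.of_norm_bounded hb fun t => ?_
    rw [norm_mul, mul_assoc, ← norm_pow]
    exact mul_le_mul (hC _) (norm_scaled_convolution_le p v x (hqi t.1) t.2) (norm_nonneg _) hC0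
  rw [tsum_congr (kernel_convolution_eq_tsum hq hA p v x),
    Summable.tsum_comm (f := fun i n => qRatio q A i * ∑ j ∈ Finset.range (n + 1 + 1),
      v j * (x * (q ^ i) ^ 2) ^ j * (p (n + 1 - j) * (x * q ^ i) ^ (n + 1 - j))) hF]
  refine tsum_congr fun i => ?_
  have hcvi := (summable_norm_sum_mul_range_of_summable_norm (hvi i) (hpi i)).of_norm
  have hprod := tsum_mul_tsum_eq_tsum_sum_range_of_summable_norm (hvi i) (hpi i)
  rw [tsum_mul_left, mul_comm (∑' m, p m * (x * q ^ i) ^ m), hprod, hcvi.tsum_eq_zero_add]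
  congr 1
  simp [mul_comm]

lemma summable_norm_mul_pow_of_bounded {v : ℕ → ℂ} {C : ℝ} (hv : ∀ n, ‖v n‖ ≤ C) {x : ℂ}
    (hx : ‖x‖ < 1) : Summable fun n => ‖v n * x ^ n‖ :=
  Summable.of_nonneg_of_le (fun _ => norm_nonneg _) (fun n => by
    rw [norm_mul, norm_pow]
    gcongr
    exact hv n) ((summable_geometric_of_lt_one (norm_nonneg x) hx).mul_left C)

lemma differentiableOn_tsum_mul_pow {v : ℕ → ℂ} {C : ℝ} (hv : ∀ n, ‖v n‖ ≤ C) :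
    DifferentiableOn ℂ (fun x => ∑' n, v n * x ^ n) (Metric.ball 0 1) := by
  intro x hx
  obtain ⟨r, hxr, hr⟩ := exists_between (mem_ball_zero_iff.1 hx)
  have hr0 : 0 ≤ r := (norm_nonneg x).trans hxr.le
  have h := Complex.differentiableOn_tsum_of_summable_norm (F := fun n x => v n * x ^ n)
    (U := Metric.ball 0 r) ((summable_geometric_of_lt_one hr0 hr).mul_left C)
    (fun n => by fun_prop) Metric.isOpen_ball (fun n y hy => by
      rw [norm_mul, norm_pow]
      have := (mem_ball_zero_iff.1 hy).le
      have := hv n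
      have : 0 ≤ C := (norm_nonneg _).trans this
      gcongr)
  exact (h.differentiableAt (Metric.isOpen_ball.mem_nhds
    (mem_ball_zero_iff.2 hxr))).differentiableWithinAt

lemma norm_tsum_mul_pow_sub_le {v : ℕ → ℂ} {C : ℝ} (hv : ∀ n, ‖v n‖ ≤ C) {r : ℝ} (hr : r < 1)
    {x : ℂ} (hx : ‖x‖ ≤ r) :
    ‖∑' n, v n * x ^ n - v 0‖ ≤ C / (1 - r) * ‖x‖ := by
  have hx1 := hx.trans_lt hr
  have hC : 0 ≤ C := (norm_nonneg _).trans (hv 0)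
  have hs := (summable_norm_mul_pow_of_bounded hv hx1).of_norm
  have hg := (summable_geometric_of_lt_one (norm_nonneg x) hx1).mul_left (C * ‖x‖)
  rw [hs.tsum_eq_zero_add, pow_zero, mul_one, add_sub_cancel_left]
  refine (tsum_of_norm_bounded hg.hasSum fun n => ?_).trans ?_
  · rw [norm_mul, norm_pow, pow_succ', ← mul_assoc]
    gcongr
    exact hv _
  · rw [tsum_mul_left, tsum_geometric_of_lt_one (norm_nonneg x) hx1, div_eq_mul_inv,
      mul_right_comm]
    gcongr

end Kernel

/-! ### Summation of a derived pair at one parameter -/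

section DerivedSum

variable {q c : ℂ}

/-- The generating function of the `α`-side. With `p` the indicator of `0`, the convolution in
`tsum_kernel_convolution` reduces to its diagonal term. -/
lemma tsum_alpha_series (hq : ‖q‖ < 1) {A : ℂ} (hA : ∀ n : ℕ, A * q ^ n ≠ 1) {v : ℕ → ℂ} {C : ℝ}
    (hv : ∀ n, ‖v n‖ ≤ C) {x : ℂ} (hx : ‖x‖ < 1) :
    ∑' n : ℕ, qPoch q q (2 * n + 1) / qPoch A q (2 * n + 2) * v (n + 1) * x ^ (n + 1) =
      ∑' i : ℕ, qRatio q A i * (∑' j, v j * (x * (q ^ i) ^ 2) ^ j - v 0) := by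
  have h := tsum_kernel_convolution hq hA (Pi.single 0 1) v x
    (summable_of_ne_finset_zero (s := {0}) fun m hm => by
      simp [Finset.notMem_singleton.1 hm])
    (summable_norm_mul_pow_of_bounded hv hx)
  have hp : ∀ y : ℂ, ∑' m, (Pi.single 0 1 : ℕ → ℂ) m * y ^ m = 1 := fun y => by
    rw [tsum_eq_single 0 fun m hm => by simp [hm]]
    simp
  simp only [hp, one_mul, Pi.single_eq_same] at h
  rw [← h]
  refine tsum_congr fun n => ?_
  rw [Finset.sum_eq_single (n + 1)]
  · simp only [tsub_self, Pi.single_eq_same, one_mul]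
    rw [show n + (n + 1) = 2 * n + 1 by ring, show n + 1 + (n + 1) = 2 * n + 2 by ring]
  · intro j hj hne
    have : n + 1 - j ≠ 0 := by
      have := Finset.mem_range.1 hj
      omega
    simp [this]
  · intro h
    simp at h

/-- For small `x`, the generating function of the `β`-side, multiplied by `(q c² x; q)_∞`. The right
side has no singularity in the unit disc. -/
lemma tsum_beta_series_of_small (hq : ‖q‖ < 1) (hc : c ≠ 0) (hA : ∀ n : ℕ, c * q * q ^ n ≠ 1)
    {v : ℕ → ℂ} (hv0 : v 0 = 1) {C : ℝ} (hv : ∀ n, ‖v n‖ ≤ C) {x : ℂ} (hx : ‖x‖ < 1)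
    (hzx : ‖q * c ^ 2 * x‖ < 1) :
    qPochInf (q * c ^ 2 * x) q * ∑' n : ℕ, (∑ j ∈ Finset.range (n + 2),
        qPoch (1 / c) q (n + 1 - j) / qPoch q q (n + 1 - j) * (q * c ^ 2) ^ (n + 1 - j) *
          (qPoch q q (n + j) / qPoch (c * q) q (n + 1 + j)) * v j) * x ^ (n + 1) =
      ∑' i : ℕ, qRatio q (c * q) i * qPoch (q * c ^ 2 * x) q i *
        (qPochInf (c * q * x * q ^ i) q * ∑' j, v j * (x * (q ^ i) ^ 2) ^ j -
          qPochInf (q * c ^ 2 * x * q ^ i) q) := by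
  have hpw : ∀ (y : ℂ) (m : ℕ), qPoch (1 / c) q m / qPoch q q m * (q * c ^ 2) ^ m * y ^ m =
      qPoch (1 / c) q m / qPoch q q m * (q * c ^ 2 * y) ^ m := fun y m => by
    rw [mul_pow (q * c ^ 2), mul_assoc]
  have h := tsum_kernel_convolution hq hA
    (fun m => qPoch (1 / c) q m / qPoch q q m * (q * c ^ 2) ^ m) v x
    (by simpa only [hpw] using summable_norm_qBinomial hq (1 / c) hzx)
    (summable_norm_mul_pow_of_bounded hv hx)
  rw [h, ← tsum_mul_left]
  refine tsum_congr fun i => ?_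
  have hzi : ‖q * c ^ 2 * (x * q ^ i)‖ < 1 := by
    rw [← mul_assoc, norm_mul, norm_pow]
    exact (mul_le_of_le_one_right (norm_nonneg _)
      (pow_le_one₀ (norm_nonneg q) hq.le)).trans_lt hzx
  have hne : qPochInf (q * c ^ 2 * x * q ^ i) q ≠ 0 := qPochInf_ne_zero hq fun n hn => by
    have h1 : ‖q * c ^ 2 * x * q ^ i * q ^ n‖ < 1 := by
      rw [norm_mul, norm_pow, mul_assoc]
      exact (mul_le_of_le_one_right (norm_nonneg _)
        (pow_le_one₀ (norm_nonneg q) hq.le)).trans_lt (by simpa [mul_assoc] using hzi)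
    rw [hn, norm_one] at h1
    exact lt_irrefl _ h1
  simp only [hpw]
  rw [tsum_qBinomial hq (1 / c) hzi, qPochInf_eq_mul_shift hq (q * c ^ 2 * x) i, hv0,
    show 1 / c * (q * c ^ 2 * (x * q ^ i)) = c * q * x * q ^ i by field_simp, ← mul_assoc _ x]
  simp only [qPoch_zero, pow_zero, div_one, mul_one]
  generalize qPochInf (q * c ^ 2 * x * q ^ i) q = P at hne ⊢
  field_simp

lemma norm_mul_sub_le {a b d : ℂ} {X Y e : ℝ} (he : e ≤ 1) (he0 : 0 ≤ e) (hX : 0 ≤ X) (hY : 0 ≤ Y)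
    (ha : ‖a - 1‖ ≤ X * e) (hb : ‖b - 1‖ ≤ Y * e) (hd : ‖d - 1‖ ≤ X * e) :
    ‖a * b - d‖ ≤ (X * Y + X + Y + X) * e := by
  have h1 : a * b - d = (a - 1) * (b - 1) + (a - 1) + (b - 1) - (d - 1) := by ring
  rw [h1]
  have h2 : ‖(a - 1) * (b - 1)‖ ≤ X * Y * e := by
    rw [norm_mul]
    calc ‖a - 1‖ * ‖b - 1‖ ≤ (X * e) * (Y * 1) := by gcongr; exact hb.trans (by gcongr)
      _ = X * Y * e := by ring
  calc _ ≤ ‖(a - 1) * (b - 1)‖ + ‖a - 1‖ + ‖b - 1‖ + ‖d - 1‖ :=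
        (norm_sub_le _ _).trans (add_le_add_left ((norm_add_le _ _).trans
          (add_le_add_left (norm_add_le _ _) _)) _)
    _ ≤ X * Y * e + X * e + Y * e + X * e := by gcongr
    _ = _ := by ring

/-- The terms of the expansion of the `β`-side are `O(q ^ i)` uniformly in the closed unit disc,
except for the first one. -/
lemma exists_beta_term_bound (hq : ‖q‖ < 1) (A z : ℂ) {V : ℂ → ℂ} {D : ℝ}
    (hD : ∀ y, ‖y‖ ≤ ‖q‖ → ‖V y - 1‖ ≤ D * ‖y‖) (hD0 : 0 ≤ D) :
    ∃ B : ℝ, ∀ (i : ℕ) (x : ℂ), ‖x‖ ≤ 1 →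
      ‖qRatio q A (i + 1) * qPoch (z * x) q (i + 1) *
        (qPochInf (A * x * q ^ (i + 1)) q * V (x * (q ^ (i + 1)) ^ 2) -
          qPochInf (z * x * q ^ (i + 1)) q)‖ ≤ B * ‖q‖ ^ (i + 1) := by
  obtain ⟨K, hK⟩ := exists_norm_le_of_tendsto (tendsto_qRatio hq A)
  obtain ⟨C, hC0, hC⟩ := exists_norm_qPoch_sub_one_le hq (‖A‖ + ‖z‖)
  have hK0 : 0 ≤ K := (norm_nonneg _).trans (hK 0)
  set X := C * (‖A‖ + ‖z‖) with hX
  have hX0 : 0 ≤ X := by positivity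
  refine ⟨K * (1 + X) * (X * D + X + D + X), fun i x hx => ?_⟩
  set e := ‖q‖ ^ (i + 1) with he
  have he0 : 0 ≤ e := by positivity
  have heq : e ≤ ‖q‖ := by
    rw [he, pow_succ]
    exact mul_le_of_le_one_left (norm_nonneg q) (pow_le_one₀ (norm_nonneg q) hq.le)
  have he1 : e ≤ 1 := heq.trans hq.le
  have hqe : ‖q ^ (i + 1)‖ = e := norm_pow _ _
  have hsmall : ∀ a : ℂ, ‖a‖ ≤ ‖A‖ + ‖z‖ → ‖qPochInf (a * x * q ^ (i + 1)) q - 1‖ ≤ X * e := by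
    intro a ha
    have h1 : ‖a * x * q ^ (i + 1)‖ ≤ (‖A‖ + ‖z‖) * 1 * e := by
      rw [norm_mul, norm_mul, hqe]
      gcongr
    refine ((hC _ (h1.trans ?_)).2).trans ?_
    · rw [mul_one]
      exact mul_le_of_le_one_right (by positivity) he1
    · refine (mul_le_mul_of_nonneg_left h1 hC0).trans (le_of_eq ?_)
      rw [hX]
      ring
  have hb : ‖V (x * (q ^ (i + 1)) ^ 2) - 1‖ ≤ D * e := by
    have h1 : ‖x * (q ^ (i + 1)) ^ 2‖ ≤ e := by
      rw [norm_mul, norm_pow, hqe, sq]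
      calc ‖x‖ * (e * e) ≤ 1 * (e * 1) := by gcongr
        _ = e := by ring
    exact (hD _ (h1.trans heq)).trans (by gcongr)
  have hp : ‖qPoch (z * x) q (i + 1)‖ ≤ 1 + X := by
    have h1 : ‖z * x‖ ≤ ‖A‖ + ‖z‖ := by
      rw [norm_mul]
      have := mul_le_of_le_one_right (norm_nonneg z) hx
      have := norm_nonneg A
      linarith
    have h2 := (hC _ h1).1 (i + 1)
    have h3 : C * ‖z * x‖ ≤ X := mul_le_mul_of_nonneg_left h1 hC0
    calc _ = ‖1 + (qPoch (z * x) q (i + 1) - 1)‖ := by rw [add_sub_cancel]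
      _ ≤ ‖(1 : ℂ)‖ + ‖qPoch (z * x) q (i + 1) - 1‖ := norm_add_le _ _
      _ ≤ 1 + X := by rw [norm_one]; linarith
  rw [norm_mul, norm_mul]
  calc _ ≤ K * (1 + X) * ((X * D + X + D + X) * e) := by
        gcongr
        · exact hK _
        · exact norm_mul_sub_le he1 he0 hX0 hD0 (hsmall A (by simp)) hb (hsmall z (by simp))
    _ = _ := by ring

/-- The approach to `1` from the left along the real axis, as a filter on `ℂ`. -/
noncomputable def leftOne : Filter ℂ := (𝓝[<] (1 : ℝ)).map Complex.ofReal

instance : leftOne.NeBot := by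
  unfold leftOne
  infer_instance

lemma leftOne_le : leftOne ≤ 𝓝 1 := by
  have h : Tendsto Complex.ofReal (𝓝[<] (1 : ℝ)) (𝓝 ((1 : ℝ) : ℂ)) :=
    (Complex.continuous_ofReal.tendsto 1).mono_left nhdsWithin_le_nhds
  rw [Complex.ofReal_one] at h
  exact h

lemma eventually_leftOne_norm_lt : ∀ᶠ x in leftOne, ‖x‖ < 1 := by
  rw [leftOne, eventually_map]
  filter_upwards [Ioo_mem_nhdsLT (zero_lt_one (α := ℝ))] with x hx
  rw [Complex.norm_real, Real.norm_eq_abs, abs_of_pos hx.1]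
  exact hx.2

/-- Abel's limit theorem for a series `∑ f n x ^ (n + 1)`. -/
lemma tendsto_leftOne_tsum {f : ℕ → ℂ} {l : ℂ}
    (h : Tendsto (fun n => ∑ i ∈ Finset.range n, f i) atTop (𝓝 l)) :
    Tendsto (fun x => ∑' n, f n * x ^ (n + 1)) leftOne (𝓝 l) := by
  have h1 := (tendsto_id.mono_left leftOne_le).mul (Complex.tendsto_tsum_powerSeries_nhdsWithin_lt h)
  rw [one_mul] at h1
  refine h1.congr fun x => ?_
  rw [id, ← tsum_mul_left]
  exact tsum_congr fun n => by ring

lemma exists_norm_le_of_tendsto_sum {f : ℕ → ℂ} {l : ℂ}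
    (h : Tendsto (fun n => ∑ i ∈ Finset.range n, f i) atTop (𝓝 l)) :
    ∃ C : ℝ, ∀ n, ‖f n‖ ≤ C := by
  refine exists_norm_le_of_tendsto (l := 0) ?_
  have := (h.comp (tendsto_add_atTop_nat 1)).sub h
  rw [sub_self] at this
  refine this.congr fun n => ?_
  simp [Finset.sum_range_succ]

lemma exists_norm_le_of_alpha_sum (hq : ‖q‖ < 1) {z : ℂ} (hz : ∀ n : ℕ, z * q ^ n ≠ 1)
    {v : ℕ → ℂ} {U : ℂ} (hu : Tendsto (fun N => ∑ n ∈ Finset.range N,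
      qPoch q q (2 * n + 1) / qPoch z q (2 * n + 2) * v (n + 1)) atTop (𝓝 U)) :
    ∃ C : ℝ, ∀ n, ‖v n‖ ≤ C := by
  obtain ⟨C, hC⟩ := exists_norm_le_of_tendsto_sum hu
  have hsub : ∀ k : ℕ, Tendsto (fun n : ℕ => 2 * n + k) atTop atTop := fun k =>
    tendsto_atTop_mono (fun n => by rw [id]; omega) tendsto_id
  have ht := ((tendsto_qPoch hq q).comp (hsub 1)).div ((tendsto_qPoch hq z).comp (hsub 2))
    (qPochInf_ne_zero hq hz)
  obtain ⟨K, hK⟩ := exists_norm_inv_le ht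
    (div_ne_zero (qPochInf_ne_zero hq (self_mul_pow_ne_one hq)) (qPochInf_ne_zero hq hz))
  refine ⟨max ‖v 0‖ (K * C), fun n => ?_⟩
  rcases n with _ | n
  · exact le_max_left _ _
  · refine le_max_of_le_right ?_
    have h1 : qPoch q q (2 * n + 1) / qPoch z q (2 * n + 2) ≠ 0 :=
      div_ne_zero (qPoch_ne_zero (self_mul_pow_ne_one hq) _) (qPoch_ne_zero hz _)
    have h2 : v (n + 1) = (qPoch q q (2 * n + 1) / qPoch z q (2 * n + 2))⁻¹ *
        (qPoch q q (2 * n + 1) / qPoch z q (2 * n + 2) * v (n + 1)) := by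
      rw [inv_mul_cancel_left₀ h1]
    rw [h2, norm_mul]
    exact mul_le_mul (hK n) (hC n) (norm_nonneg _) ((norm_nonneg _).trans (hK 0))

/-- The identity `tsum_beta_series_of_small` in the whole unit disc, by analytic continuation. -/
lemma tsum_beta_series (hq : ‖q‖ < 1) (hc : c ≠ 0) (hA : ∀ n : ℕ, c * q * q ^ n ≠ 1)
    {v : ℕ → ℂ} (hv0 : v 0 = 1) {C : ℝ} (hv : ∀ n, ‖v n‖ ≤ C) {w : ℕ → ℂ} {E : ℝ}
    (hw : ∀ n, w n = ∑ j ∈ Finset.range (n + 2),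
        qPoch (1 / c) q (n + 1 - j) / qPoch q q (n + 1 - j) * (q * c ^ 2) ^ (n + 1 - j) *
          (qPoch q q (n + j) / qPoch (c * q) q (n + 1 + j)) * v j)
    (hwE : ∀ n, ‖w n‖ ≤ E) {x : ℂ} (hx : ‖x‖ < 1) :
    qPochInf (q * c ^ 2 * x) q * ∑' n : ℕ, w n * x ^ (n + 1) =
      ∑' i : ℕ, qRatio q (c * q) i * qPoch (q * c ^ 2 * x) q i *
        (qPochInf (c * q * x * q ^ i) q * ∑' j, v j * (x * (q ^ i) ^ 2) ^ j -
          qPochInf (q * c ^ 2 * x * q ^ i) q) := by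
  have hVd := differentiableOn_tsum_mul_pow hv
  have hD : ∀ y, ‖y‖ ≤ ‖q‖ → ‖∑' j, v j * y ^ j - 1‖ ≤ C / (1 - ‖q‖) * ‖y‖ := fun y hy => by
    rw [← hv0]
    exact norm_tsum_mul_pow_sub_le hv hq hy
  have hC0 : 0 ≤ C := (norm_nonneg _).trans (hv 0)
  obtain ⟨B, hB⟩ := exists_beta_term_bound hq (c * q) (q * c ^ 2) hD
    (div_nonneg hC0 (sub_pos.2 hq).le)
  have hgeo : Summable fun i : ℕ => B * ‖q‖ ^ (i + 1) :=
    ((summable_nat_add_iff 1).2 (summable_geometric_of_lt_one (norm_nonneg q) hq)).mul_left B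
  have hmem : ∀ (i : ℕ) (x : ℂ), x ∈ Metric.ball (0 : ℂ) 1 →
      x * (q ^ i) ^ 2 ∈ Metric.ball (0 : ℂ) 1 := fun i x hx => by
    rw [mem_ball_zero_iff] at hx ⊢
    rw [norm_mul, ← pow_mul, norm_pow]
    exact (mul_le_of_le_one_right (norm_nonneg _)
      (pow_le_one₀ (norm_nonneg q) hq.le)).trans_lt hx
  have hTd : ∀ i : ℕ, DifferentiableOn ℂ (fun x => qRatio q (c * q) i *
      qPoch (q * c ^ 2 * x) q i * (qPochInf (c * q * x * q ^ i) q *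
        ∑' j, v j * (x * (q ^ i) ^ 2) ^ j - qPochInf (q * c ^ 2 * x * q ^ i) q))
      (Metric.ball 0 1) := by
    intro i
    have d1 : Differentiable ℂ fun x => qPoch (q * c ^ 2 * x) q i :=
      (differentiable_qPoch q i).comp (by fun_prop : Differentiable ℂ fun x => q * c ^ 2 * x)
    have d2 : Differentiable ℂ fun x => qPochInf (c * q * x * q ^ i) q :=
      (differentiable_qPochInf hq).comp
        (by fun_prop : Differentiable ℂ fun x => c * q * x * q ^ i)
    have d3 : Differentiable ℂ fun x => qPochInf (q * c ^ 2 * x * q ^ i) q :=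
      (differentiable_qPochInf hq).comp
        (by fun_prop : Differentiable ℂ fun x => q * c ^ 2 * x * q ^ i)
    have d4 : DifferentiableOn ℂ (fun x => ∑' j, v j * (x * (q ^ i) ^ 2) ^ j) (Metric.ball 0 1) :=
      hVd.comp (by fun_prop : DifferentiableOn ℂ (fun x => x * (q ^ i) ^ 2) (Metric.ball 0 1))
        (hmem i)
    exact (d1.differentiableOn.const_mul _).mul
      ((d2.differentiableOn.mul d4).sub d3.differentiableOn)
  have hRd : DifferentiableOn ℂ (fun x => ∑' i : ℕ, qRatio q (c * q) i *
      qPoch (q * c ^ 2 * x) q i * (qPochInf (c * q * x * q ^ i) q *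
        ∑' j, v j * (x * (q ^ i) ^ 2) ^ j - qPochInf (q * c ^ 2 * x * q ^ i) q))
      (Metric.ball 0 1) := by
    have h := (hTd 0).add (Complex.differentiableOn_tsum_of_summable_norm hgeo
      (fun i => hTd (i + 1)) Metric.isOpen_ball fun i x hx =>
        hB i x (mem_ball_zero_iff.1 hx).le)
    refine h.congr fun x hx => ?_
    refine Summable.tsum_eq_zero_add ((summable_nat_add_iff 1).1 ?_)
    exact Summable.of_norm_bounded hgeo fun i => hB i x (mem_ball_zero_iff.1 hx).le
  have hLd : DifferentiableOn ℂ
      (fun x => qPochInf (q * c ^ 2 * x) q * ∑' n : ℕ, w n * x ^ (n + 1)) (Metric.ball 0 1) := by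
    have d1 : Differentiable ℂ fun x => qPochInf (q * c ^ 2 * x) q :=
      (differentiable_qPochInf hq).comp (by fun_prop : Differentiable ℂ fun x => q * c ^ 2 * x)
    have d2 : DifferentiableOn ℂ (fun x => x * ∑' n : ℕ, w n * x ^ n) (Metric.ball 0 1) :=
      differentiableOn_id.mul (differentiableOn_tsum_mul_pow hwE)
    refine d1.differentiableOn.mul (d2.congr fun x _ => ?_)
    rw [← tsum_mul_left]
    exact tsum_congr fun n => by ring
  -- both sides are analytic in the unit disc and agree near the origin
  refine (hLd.analyticOnNhd Metric.isOpen_ball).eqOn_of_preconnected_of_eventuallyEq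
    (hRd.analyticOnNhd Metric.isOpen_ball) (convex_ball (0 : ℂ) 1).isPreconnected
    (Metric.mem_ball_self one_pos) ?_ (mem_ball_zero_iff.2 hx)
  have e1 : ∀ᶠ x : ℂ in 𝓝 0, ‖x‖ < 1 :=
    (continuous_norm.tendsto (0 : ℂ)).eventually_lt_const (by simp)
  have e2 : ∀ᶠ x : ℂ in 𝓝 0, ‖q * c ^ 2 * x‖ < 1 :=
    ((by fun_prop : Continuous fun x : ℂ => ‖q * c ^ 2 * x‖).tendsto 0).eventually_lt_const
      (by simp)
  filter_upwards [e1, e2] with y hy hzy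
  simp only [hw]
  exact tsum_beta_series_of_small hq hc hA hv0 hv hy hzy

/-- The difference between the `β`-sum and the `α`-sum of a derived pair, both taken conditionally.
No bound on `q c²` is needed: poles of the generating function of the `β`-side in the unit
disc do no harm, because Abel's theorem is applied after clearing them. -/
theorem hasSum_beta_sub_alpha (hq : ‖q‖ < 1) (hc : c ≠ 0) (hA : ∀ n : ℕ, c * q * q ^ n ≠ 1)
    (hz : ∀ n : ℕ, q * c ^ 2 * q ^ n ≠ 1) {v : ℕ → ℂ} (hv0 : v 0 = 1) {w : ℕ → ℂ} {W U : ℂ}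
    (hw : ∀ n, w n = ∑ j ∈ Finset.range (n + 2),
        qPoch (1 / c) q (n + 1 - j) / qPoch q q (n + 1 - j) * (q * c ^ 2) ^ (n + 1 - j) *
          (qPoch q q (n + j) / qPoch (c * q) q (n + 1 + j)) * v j)
    (hW : Tendsto (fun N => ∑ n ∈ Finset.range N, w n) atTop (𝓝 W))
    (hU : Tendsto (fun N => ∑ n ∈ Finset.range N,
      qPoch q q (2 * n + 1) / qPoch (q * c ^ 2) q (2 * n + 2) * v (n + 1)) atTop (𝓝 U)) :
    HasSum (fun i => qRatio q (q * c ^ 2) i - qRatio q (c * q) i) (W - U) := by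
  set z := q * c ^ 2 with hzdef
  obtain ⟨C, hv⟩ := exists_norm_le_of_alpha_sum hq hz hU
  obtain ⟨E, hwE⟩ := exists_norm_le_of_tendsto_sum hW
  have hC0 : 0 ≤ C := (norm_nonneg _).trans (hv 0)
  have hq' : 0 < 1 - ‖q‖ := sub_pos.2 hq
  have hD0 : 0 ≤ C / (1 - ‖q‖) := div_nonneg hC0 hq'.le
  have hD : ∀ y, ‖y‖ ≤ ‖q‖ → ‖∑' j, v j * y ^ j - 1‖ ≤ C / (1 - ‖q‖) * ‖y‖ := fun y hy => by
    rw [← hv0]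
    exact norm_tsum_mul_pow_sub_le hv hq hy
  set V : ℂ → ℂ := fun y => ∑' j, v j * y ^ j with hV
  have hgeo : ∀ B : ℝ, Summable fun i : ℕ => B * ‖q‖ ^ (i + 1) := fun B =>
    ((summable_nat_add_iff 1).2 (summable_geometric_of_lt_one (norm_nonneg q) hq)).mul_left B
  have hqi : ∀ i : ℕ, ‖q ^ (i + 1)‖ < 1 := norm_self_pow_lt_one hq
  -- `V` is continuous at the points `q ^ (2 i)`, `i ≥ 1`
  have hVlim : ∀ i : ℕ, Tendsto (fun x => V (x * (q ^ (i + 1)) ^ 2)) leftOne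
      (𝓝 (V ((q ^ (i + 1)) ^ 2))) := by
    intro i
    have hmem : (q ^ (i + 1)) ^ 2 ∈ Metric.ball (0 : ℂ) 1 := by
      rw [mem_ball_zero_iff, norm_pow]
      exact pow_lt_one₀ (norm_nonneg _) (hqi i) two_ne_zero
    have hc1 : ContinuousAt V ((q ^ (i + 1)) ^ 2) :=
      ((differentiableOn_tsum_mul_pow hv).differentiableAt
        (Metric.isOpen_ball.mem_nhds hmem)).continuousAt
    have hc2 : Tendsto (fun x : ℂ => x * (q ^ (i + 1)) ^ 2) leftOne (𝓝 ((q ^ (i + 1)) ^ 2)) := by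
      simpa using (tendsto_id.mono_left leftOne_le).mul_const ((q ^ (i + 1)) ^ 2)
    exact hc1.tendsto.comp hc2
  -- the `α`-side
  obtain ⟨K, hK⟩ := exists_norm_le_of_tendsto (tendsto_qRatio hq z)
  have hK0 : 0 ≤ K := (norm_nonneg _).trans (hK 0)
  have hSb : ∀ (i : ℕ) (x : ℂ), ‖x‖ ≤ 1 →
      ‖qRatio q z (i + 1) * (V (x * (q ^ (i + 1)) ^ 2) - 1)‖ ≤
        K * (C / (1 - ‖q‖)) * ‖q‖ ^ (i + 1) := by
    intro i x hx
    have h1 : ‖x * (q ^ (i + 1)) ^ 2‖ ≤ ‖q‖ ^ (i + 1) := by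
      rw [norm_mul, sq, norm_mul, ← norm_pow]
      calc ‖x‖ * (‖q ^ (i + 1)‖ * ‖q ^ (i + 1)‖) ≤ 1 * (‖q ^ (i + 1)‖ * 1) := by
            gcongr
            exact (hqi i).le
        _ = _ := by ring
    have h2 : ‖q‖ ^ (i + 1) ≤ ‖q‖ := by
      rw [pow_succ]
      exact mul_le_of_le_one_left (norm_nonneg q) (pow_le_one₀ (norm_nonneg q) hq.le)
    rw [norm_mul, mul_assoc]
    refine mul_le_mul (hK _) ((hD _ (h1.trans h2)).trans ?_) (norm_nonneg _) hK0
    gcongr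
  have hS1 : Summable fun i => qRatio q z (i + 1) * (V ((q ^ (i + 1)) ^ 2) - 1) :=
    Summable.of_norm_bounded (hgeo _) fun i => by simpa using hSb i 1 (by simp)
  have hSlim : Tendsto (fun x => ∑' i, qRatio q z (i + 1) * (V (x * (q ^ (i + 1)) ^ 2) - 1))
      leftOne (𝓝 (∑' i, qRatio q z (i + 1) * (V ((q ^ (i + 1)) ^ 2) - 1))) :=
    tendsto_tsum_of_dominated_convergence (hgeo _)
      (fun i => ((hVlim i).sub_const 1).const_mul _)
      (eventually_leftOne_norm_lt.mono fun x hx i => hSb i x hx.le)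
  have hl0 : qRatio q z 0 ≠ 0 := by
    rw [qRatio, pow_zero, mul_one, mul_one]
    exact div_ne_zero (qPochInf_ne_zero hq (self_mul_pow_ne_one hq)) (qPochInf_ne_zero hq hz)
  -- solving the expansion of the `α`-side for its first term shows that `V` has a limit at `1`
  have hV1 : Tendsto V leftOne (𝓝 ((U - ∑' i, qRatio q z (i + 1) *
      (V ((q ^ (i + 1)) ^ 2) - 1)) / qRatio q z 0 + 1)) := by
    refine ((((tendsto_leftOne_tsum hU).sub hSlim).div_const (qRatio q z 0)).add_const 1).congr' ?_
    filter_upwards [eventually_leftOne_norm_lt] with x hx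
    have hs : Summable fun i => qRatio q z i * (V (x * (q ^ i) ^ 2) - 1) :=
      (summable_nat_add_iff 1).1 (Summable.of_norm_bounded (hgeo _) fun i => hSb i x hx.le)
    have h1 := tsum_alpha_series hq hz hv hx
    rw [hv0] at h1
    rw [h1, hs.tsum_eq_zero_add]
    simp only [pow_zero, one_pow, mul_one, add_sub_cancel_right]
    rw [mul_div_cancel_left₀ _ hl0, sub_add_cancel]
  set V1 := (U - ∑' i, qRatio q z (i + 1) * (V ((q ^ (i + 1)) ^ 2) - 1)) / qRatio q z 0 + 1
    with hV1def
  have hUeq : U = qRatio q z 0 * (V1 - 1) +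
      ∑' i, qRatio q z (i + 1) * (V ((q ^ (i + 1)) ^ 2) - 1) := by
    rw [hV1def]
    field_simp
    ring
  -- the `β`-side
  obtain ⟨B, hB⟩ := exists_beta_term_bound hq (c * q) z hD hD0
  have hcont : ∀ (a : ℂ) (i : ℕ), Tendsto (fun x => qPochInf (a * x * q ^ i) q) leftOne
      (𝓝 (qPochInf (a * q ^ i) q)) := by
    intro a i
    have h := ((continuous_qPochInf hq).comp
      (by fun_prop : Continuous fun x : ℂ => a * x * q ^ i)).tendsto 1
    simp only [Function.comp_apply, mul_one] at h
    exact h.mono_left leftOne_le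
  have hcont' : ∀ i : ℕ, Tendsto (fun x => qPoch (z * x) q i) leftOne (𝓝 (qPoch z q i)) := by
    intro i
    have h := ((continuous_qPoch q i).comp
      (by fun_prop : Continuous fun x : ℂ => z * x)).tendsto 1
    simp only [Function.comp_apply, mul_one] at h
    exact h.mono_left leftOne_le
  have hzz := qPochInf_ne_zero hq hz
  have hval : ∀ (i : ℕ) (y : ℂ), qRatio q (c * q) i * qPoch z q i *
      (qPochInf (c * q * q ^ i) q * y - qPochInf (z * q ^ i) q) =
        qPochInf z q * (qRatio q z i * y - qRatio q (c * q) i) := by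
    intro i y
    have h1 := qPochInf_ne_zero hq (mul_pow_shift_ne_one hz i)
    have h2 := qPochInf_ne_zero hq (mul_pow_shift_ne_one hA i)
    rw [qRatio, qRatio, qPochInf_eq_mul_shift hq z i]
    generalize qPochInf (z * q ^ i) q = P1 at h1 ⊢
    generalize qPochInf (c * q * q ^ i) q = P2 at h2 ⊢
    field_simp
  have hTlim : Tendsto (fun x => ∑' i, qRatio q (c * q) (i + 1) * qPoch (z * x) q (i + 1) *
        (qPochInf (c * q * x * q ^ (i + 1)) q * V (x * (q ^ (i + 1)) ^ 2) -
          qPochInf (z * x * q ^ (i + 1)) q)) leftOne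
      (𝓝 (∑' i, qPochInf z q * (qRatio q z (i + 1) * V ((q ^ (i + 1)) ^ 2) -
        qRatio q (c * q) (i + 1)))) := by
    refine tendsto_tsum_of_dominated_convergence (hgeo B) (fun i => ?_)
      (eventually_leftOne_norm_lt.mono fun x hx i => hB i x hx.le)
    rw [← hval]
    exact ((hcont' _).const_mul _).mul (((hcont _ _).mul (hVlim i)).sub (hcont _ _))
  have hT1 : Summable fun i => qRatio q z (i + 1) * V ((q ^ (i + 1)) ^ 2) -
      qRatio q (c * q) (i + 1) := by
    have h : Summable fun i => qPochInf z q * (qRatio q z (i + 1) * V ((q ^ (i + 1)) ^ 2) -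
        qRatio q (c * q) (i + 1)) :=
      Summable.of_norm_bounded (hgeo B) fun i => by
        rw [← hval]
        simpa only [mul_one, one_mul] using hB i 1 (by simp)
    exact (summable_mul_left_iff hzz).1 h
  have hW1 : qPochInf z q * W = qPochInf z q * (qRatio q z 0 * V1 - qRatio q (c * q) 0) +
      ∑' i, qPochInf z q * (qRatio q z (i + 1) * V ((q ^ (i + 1)) ^ 2) -
        qRatio q (c * q) (i + 1)) := by
    have hL : Tendsto (fun x => qPochInf (z * x) q * ∑' n, w n * x ^ (n + 1)) leftOne
        (𝓝 (qPochInf z q * W)) := by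
      have h := hcont z 0
      simp only [pow_zero, mul_one] at h
      exact h.mul (tendsto_leftOne_tsum hW)
    have h0 : Tendsto (fun x => qRatio q (c * q) 0 * qPoch (z * x) q 0 *
        (qPochInf (c * q * x * q ^ 0) q * V x - qPochInf (z * x * q ^ 0) q)) leftOne
        (𝓝 (qPochInf z q * (qRatio q z 0 * V1 - qRatio q (c * q) 0))) := by
      rw [← hval]
      exact ((hcont' 0).const_mul _).mul (((hcont _ _).mul hV1).sub (hcont _ _))
    refine tendsto_nhds_unique hL ((h0.add hTlim).congr' ?_)
    filter_upwards [eventually_leftOne_norm_lt] with x hx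
    have hs : Summable fun i => qRatio q (c * q) i * qPoch (z * x) q i *
        (qPochInf (c * q * x * q ^ i) q * ∑' j, v j * (x * (q ^ i) ^ 2) ^ j -
          qPochInf (z * x * q ^ i) q) :=
      (summable_nat_add_iff 1).1 (Summable.of_norm_bounded (hgeo B) fun i => hB i x hx.le)
    rw [tsum_beta_series hq hc hA hv0 hv hw hwE hx, hs.tsum_eq_zero_add]
    simp [hV]
  rw [tsum_mul_left, ← mul_add] at hW1
  have hW2 := mul_left_cancel₀ hzz hW1
  have hsum : HasSum (fun i => qRatio q z (i + 1) - qRatio q (c * q) (i + 1))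
      (W - U - (qRatio q z 0 - qRatio q (c * q) 0)) := by
    have h := hT1.hasSum.sub hS1.hasSum
    have e : W - U - (qRatio q z 0 - qRatio q (c * q) 0) =
        ∑' i, (qRatio q z (i + 1) * V ((q ^ (i + 1)) ^ 2) - qRatio q (c * q) (i + 1)) -
          ∑' i, qRatio q z (i + 1) * (V ((q ^ (i + 1)) ^ 2) - 1) := by
      linear_combination hW2 - hUeq
    rw [e]
    exact h.congr_fun fun i => by ring
  rw [← hasSum_nat_add_iff' 1]
  simpa using hsum

end DerivedSum

/-! ### Lambert series -/

section Lambert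

variable {q : ℂ}

lemma exists_norm_qRatio_sub_one_le (hq : ‖q‖ < 1) {A : ℂ} (hA : ∀ n : ℕ, A * q ^ n ≠ 1) :
    ∃ C : ℝ, ∀ n i : ℕ, ‖qRatio q (A * q ^ n) i - 1‖ ≤ C * ‖q‖ ^ i := by
  obtain ⟨K, hK⟩ := exists_norm_inv_le (tendsto_qPochInf_mul_pow hq A) one_ne_zero
  have hK0 : 0 ≤ K := (norm_nonneg _).trans (hK 0)
  obtain ⟨C, hC0, hC⟩ := exists_norm_qPoch_sub_one_le hq (‖q‖ + ‖A‖)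
  have hpow : ∀ m : ℕ, ‖q‖ ^ m ≤ 1 := fun m => pow_le_one₀ (norm_nonneg q) hq.le
  have hb : ∀ (a : ℂ) (n i : ℕ), ‖a‖ ≤ ‖q‖ + ‖A‖ →
      ‖qPochInf (a * q ^ n * q ^ i) q - 1‖ ≤ C * ((‖q‖ + ‖A‖) * ‖q‖ ^ i) := by
    intro a n i ha
    have h1 : ‖a * q ^ n * q ^ i‖ ≤ (‖q‖ + ‖A‖) * ‖q‖ ^ i := by
      rw [norm_mul, norm_mul, norm_pow, norm_pow]
      gcongr
      exact (mul_le_of_le_one_right (norm_nonneg a) (hpow n)).trans ha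
    refine ((hC _ (h1.trans (mul_le_of_le_one_right (by positivity) (hpow i)))).2).trans ?_
    gcongr
  refine ⟨2 * (C * (‖q‖ + ‖A‖)) * K, fun n i => ?_⟩
  have hne := qPochInf_ne_zero hq (mul_pow_shift_ne_one (mul_pow_shift_ne_one hA n) i)
  have h1 := hb q 0 i (by simp)
  have h2 := hb A n i (by simp)
  rw [pow_zero, mul_one] at h1
  have h3 : qRatio q (A * q ^ n) i - 1 = ((qPochInf (q * q ^ i) q - 1) -
      (qPochInf (A * q ^ n * q ^ i) q - 1)) * (qPochInf (A * q ^ n * q ^ i) q)⁻¹ := by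
    rw [qRatio, div_eq_mul_inv]
    have := mul_inv_cancel₀ hne
    linear_combination this
  have h4 : ‖(qPochInf (A * q ^ n * q ^ i) q)⁻¹‖ ≤ K := by
    rw [mul_assoc, ← pow_add]
    exact hK _
  rw [h3, norm_mul]
  calc _ ≤ (C * ((‖q‖ + ‖A‖) * ‖q‖ ^ i) + C * ((‖q‖ + ‖A‖) * ‖q‖ ^ i)) * K := by
        gcongr
        exact (norm_sub_le _ _).trans (add_le_add h1 h2)
    _ = _ := by ring

lemma hasSum_qRatio_sub_shift (hq : ‖q‖ < 1) {A : ℂ} (hA : ∀ n : ℕ, A * q ^ n ≠ 1) :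
    HasSum (fun i => qRatio q A i - qRatio q (A * q) i) (A / (1 - A)) := by
  have h := (hasSum_qRatio_mul_pow hq hA 0).mul_left A
  have e : A / (1 - A) = A * (qPoch q q 0 / qPoch A q (0 + 1)) := by
    simp [qPoch, div_eq_mul_inv]
  rw [e]
  refine h.congr_fun fun i => ?_
  have hne := qPochInf_ne_zero hq (mul_pow_shift_ne_one hA (i + 1))
  have hne' : 1 - A * q ^ i ≠ 0 := sub_ne_zero.2 (hA i).symm
  have h1 := qPochInf_eq_one_sub_mul hq (A * q ^ i)
  have e2 : A * q * q ^ i = A * q ^ (i + 1) := by ring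
  rw [mul_assoc A, ← pow_succ] at h1
  rw [qRatio, qRatio, h1, e2, zero_add, pow_one]
  generalize qPochInf (A * q ^ (i + 1)) q = P at hne ⊢
  generalize q ^ i = u at hne' ⊢
  rw [mul_comm A u] at hne' ⊢
  field_simp
  ring

lemma summable_lambert (hq : ‖q‖ < 1) (A : ℂ) :
    Summable fun n : ℕ => A * q ^ n / (1 - A * q ^ n) := by
  have ht : Tendsto (fun n : ℕ => 1 - A * q ^ n) atTop (𝓝 1) := by
    simpa using (tendsto_mul_pow_zero hq A).const_sub 1
  obtain ⟨K, hK⟩ := exists_norm_inv_le ht one_ne_zero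
  refine Summable.of_norm_bounded
    ((summable_geometric_of_lt_one (norm_nonneg q) hq).mul_left (‖A‖ * K)) fun n => ?_
  rw [div_eq_mul_inv, norm_mul, norm_mul, norm_pow, mul_right_comm]
  gcongr
  exact hK n

/-- A Lambert series as a sum of ratios of infinite products. Passing from `A` to `A q` removes one
term of the Lambert series. -/
lemma hasSum_qRatio_sub_qRatio_zero (hq : ‖q‖ < 1) {A : ℂ} (hA : ∀ n : ℕ, A * q ^ n ≠ 1) :
    HasSum (fun i => qRatio q A i - qRatio q 0 i) (∑' n : ℕ, A * q ^ n / (1 - A * q ^ n)) := by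
  obtain ⟨C, hC⟩ := exists_norm_qRatio_sub_one_le hq hA
  obtain ⟨C', hC'⟩ := exists_norm_qRatio_sub_one_le hq (A := 0) (by simp)
  have hgeo : ∀ B : ℝ, Summable fun i : ℕ => B * ‖q‖ ^ i := fun B =>
    (summable_geometric_of_lt_one (norm_nonneg q) hq).mul_left B
  have hs : ∀ n, Summable fun i => qRatio q (A * q ^ n) i - 1 := fun n =>
    Summable.of_norm_bounded (hgeo C) (hC n)
  have hs0 : Summable fun i => qRatio q 0 i - 1 :=
    Summable.of_norm_bounded (hgeo C') fun i => by simpa using hC' 0 i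
  have hstep : ∀ n, ∑' i, (qRatio q (A * q ^ n) i - 1) - ∑' i, (qRatio q (A * q ^ (n + 1)) i - 1) =
      A * q ^ n / (1 - A * q ^ n) := by
    intro n
    rw [← (hs n).tsum_sub (hs (n + 1)),
      ← (hasSum_qRatio_sub_shift hq (mul_pow_shift_ne_one hA n)).tsum_eq]
    refine tsum_congr fun i => ?_
    rw [pow_succ, mul_assoc A]
    ring
  have hpart : ∀ N, ∑ n ∈ Finset.range N, A * q ^ n / (1 - A * q ^ n) =
      ∑' i, (qRatio q A i - 1) - ∑' i, (qRatio q (A * q ^ N) i - 1) := by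
    intro N
    rw [Finset.sum_congr rfl fun n _ => (hstep n).symm, Finset.sum_range_sub']
    simp
  have hlim : Tendsto (fun N => ∑' i, (qRatio q (A * q ^ N) i - 1)) atTop
      (𝓝 (∑' i, (qRatio q 0 i - 1))) := by
    refine tendsto_tsum_of_dominated_convergence (hgeo C) (fun i => ?_)
      (Eventually.of_forall fun n i => hC n i)
    refine Tendsto.sub_const ?_ 1
    have h := (tendsto_const_nhds (x := qPochInf (q * q ^ i) q)).div
      (tendsto_qPochInf_mul_pow hq (A * q ^ i)) one_ne_zero
    have e : qRatio q 0 i = qPochInf (q * q ^ i) q / 1 := by simp [qRatio, qPochInf_zero]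
    rw [e]
    refine h.congr fun N => ?_
    rw [qRatio, mul_right_comm]
    rfl
  have hval := tendsto_nhds_unique (summable_lambert hq A).hasSum.tendsto_sum_nat
    ((hlim.const_sub _).congr fun N => (hpart N).symm)
  rw [hval]
  have h0 := hs 0
  simp only [pow_zero, mul_one] at h0
  exact (h0.hasSum.sub hs0.hasSum).congr_fun fun i => by ring

/-- The Lambert-type series `∑_{n ≥ 1} c q ^ n / (1 - c ^ 2 q ^ (2 n))`. -/
noncomputable def oddLambert (q c : ℂ) : ℂ :=
  ∑' n : ℕ, c * q ^ (n + 1) / (1 - c ^ 2 * (q ^ (n + 1)) ^ 2)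

lemma hasSum_qRatio_neg_sub (hq : ‖q‖ < 1) {c : ℂ} (hc : ∀ n : ℕ, c * q * q ^ n ≠ 1)
    (hc' : ∀ n : ℕ, -c * q * q ^ n ≠ 1) :
    HasSum (fun i => qRatio q (-c * q) i - qRatio q (c * q) i) (-2 * oddLambert q c) := by
  have h := (hasSum_qRatio_sub_qRatio_zero hq hc').sub (hasSum_qRatio_sub_qRatio_zero hq hc)
  rw [← (summable_lambert hq _).tsum_sub (summable_lambert hq _)] at h
  have e : -2 * oddLambert q c = ∑' n : ℕ, (-c * q * q ^ n / (1 - -c * q * q ^ n) -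
      c * q * q ^ n / (1 - c * q * q ^ n)) := by
    rw [oddLambert, ← tsum_mul_left]
    refine tsum_congr fun n => ?_
    have h1 : 1 - c * (q * q ^ n) ≠ 0 := sub_ne_zero.2 (by rw [← mul_assoc]; exact (hc n).symm)
    have h2 : 1 + c * (q * q ^ n) ≠ 0 := fun h0 => hc' n (by linear_combination -h0)
    rw [pow_succ', mul_assoc, mul_assoc]
    generalize q * q ^ n = u at h1 h2 ⊢
    have h3 : 1 - c ^ 2 * u ^ 2 = (1 - c * u) * (1 + c * u) := by ring
    have h4 : 1 - -c * u = 1 + c * u := by ring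
    rw [h3, h4]
    field_simp
    ring
  rw [e]
  exact h.congr_fun fun i => by ring

end Lambert

/-! ### Derived WP-Bailey pairs -/

section Derived

variable {q : ℂ}

/-- The relation between the two sequences of a derived pair, obtained by dividing the relation of
the WP-Bailey pairs by `1 - k` and letting `k → 1`. -/
lemma derived_beta_eq (hq : ‖q‖ < 1) {c : ℂ} (hc : ∀ n : ℕ, c * q * q ^ n ≠ 1)
    {α β : ℂ → ℂ → ℕ → ℂ} {αs βs : ℕ → ℂ}
    (hpair : ∀ᶠ k in 𝓝[≠] (1 : ℂ), IsWPBaileyPair q c k (α c k) (β c k))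
    (hd : IsDerivedPair α β c αs βs) (n : ℕ) :
    βs (n + 1) = ∑ j ∈ Finset.range (n + 2), qPoch (1 / c) q (n + 1 - j) / qPoch q q (n + 1 - j) *
      (qPoch q q (n + j) / qPoch (c * q) q (n + 1 + j)) * if j = 0 then 1 else αs j := by
  have hlim : Tendsto (fun k : ℂ => ∑ j ∈ Finset.range (n + 2),
      qPoch (k / c) q (n + 1 - j) / qPoch q q (n + 1 - j) *
      (qPoch (k * q) q (n + j) / qPoch (c * q) q (n + 1 + j)) * α c k j) (𝓝[≠] 1)
      (𝓝 (∑ j ∈ Finset.range (n + 2), qPoch (1 / c) q (n + 1 - j) / qPoch q q (n + 1 - j) *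
      (qPoch q q (n + j) / qPoch (c * q) q (n + 1 + j)) * if j = 0 then 1 else αs j)) := by
    refine tendsto_finsetSum _ fun j _ => Tendsto.mul (Tendsto.mul (Tendsto.div_const ?_ _)
      (Tendsto.div_const ?_ _)) ?_
    · have h := ((continuous_qPoch q (n + 1 - j)).comp
        (by fun_prop : Continuous fun k : ℂ => k / c)).tendsto 1
      exact h.mono_left nhdsWithin_le_nhds
    · have h := ((continuous_qPoch q (n + j)).comp
        (by fun_prop : Continuous fun k : ℂ => k * q)).tendsto 1
      simp only [Function.comp_apply, one_mul] at h
      exact h.mono_left nhdsWithin_le_nhds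
    · split_ifs with hj
      · refine tendsto_const_nhds.congr' ?_
        filter_upwards [hpair] with k hk
        rw [hj, hk.1]
      · exact (hd j (Nat.one_le_iff_ne_zero.2 hj)).1
  refine tendsto_nhds_unique (hd (n + 1) (Nat.le_add_left 1 n)).2 (hlim.congr' ?_)
  filter_upwards [hpair, self_mem_nhdsWithin] with k hk hk1
  have hk1' : 1 - k ≠ 0 := sub_ne_zero.2 (Ne.symm hk1)
  rw [hk.2.2 (n + 1), Finset.sum_div]
  refine Finset.sum_congr rfl fun j _ => ?_
  rw [show qPoch k q (n + 1 + j) = (1 - k) * qPoch (k * q) q (n + j) by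
    rw [add_right_comm, qPoch_succ']]
  have h1 := qPoch_ne_zero (self_mul_pow_ne_one hq) (n + 1 - j)
  have h2 := qPoch_ne_zero hc (n + 1 + j)
  generalize qPoch (k / c) q (n + 1 - j) = P
  generalize qPoch (k * q) q (n + j) = P'
  generalize qPoch (c * q) q (n + 1 + j) = P'' at h2 ⊢
  field_simp

lemma tendsto_seriesSum {u : ℕ → ℂ} (hu : SeriesConverges u) :
    Tendsto (fun N => ∑ n ∈ Finset.range N, u (n + 1)) atTop (𝓝 (seriesSum u)) := by
  have h := Summable.hasSum hu
  rw [HasSum, SummationFilter.conditional_filter_eq_map_range, tendsto_map'_iff] at h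
  exact h

lemma hasSum_betaTerm_sub_alphaTerm (hq : ‖q‖ < 1) {a c : ℂ} (hac : c ^ 2 = a ^ 2) (hc0 : c ≠ 0)
    (hc : ∀ n : ℕ, c * q * q ^ n ≠ 1) (hc2 : ∀ n : ℕ, q * c ^ 2 * q ^ n ≠ 1)
    {α β : ℂ → ℂ → ℕ → ℂ} {αs βs : ℂ → ℕ → ℂ}
    (hpair : ∀ᶠ k in 𝓝[≠] (1 : ℂ), IsWPBaileyPair q c k (α c k) (β c k))
    (hd : IsDerivedPair α β c (αs c) (βs c)) (hβ : SeriesConverges (betaTerm βs q a c))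
    (hα : SeriesConverges (alphaTerm αs q a c)) :
    HasSum (fun i => qRatio q (q * a ^ 2) i - qRatio q (c * q) i)
      (seriesSum (betaTerm βs q a c) - seriesSum (alphaTerm αs q a c)) := by
  have hzpow : ∀ n : ℕ, a ^ (2 * n) * q ^ n = (q * c ^ 2) ^ n := fun n => by
    rw [hac, mul_pow, pow_mul, mul_comm]
  rw [← hac]
  refine hasSum_beta_sub_alpha hq hc0 hc hc2
    (v := fun j => (q * c ^ 2) ^ j * if j = 0 then 1 else αs c j) (by simp) (fun n => ?_)
    (tendsto_seriesSum hβ) ?_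
  · rw [betaTerm, hzpow, derived_beta_eq hq hc hpair hd, Finset.mul_sum]
    refine Finset.sum_congr rfl fun j hj => ?_
    have hj' : j ≤ n + 1 := Nat.lt_succ_iff.1 (Finset.mem_range.1 hj)
    have e : (q * c ^ 2) ^ (n + 1) = (q * c ^ 2) ^ (n + 1 - j) * (q * c ^ 2) ^ j := by
      rw [← pow_add, Nat.sub_add_cancel hj']
    rw [e]
    ring
  · refine (tendsto_seriesSum hα).congr fun N => Finset.sum_congr rfl fun n _ => ?_
    rw [alphaTerm, mul_assoc _ (a ^ _), hzpow, hac, if_neg (Nat.succ_ne_zero n), ← mul_assoc]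
    rfl

lemma mul_pow_ne_one_of_sq {a : ℂ} (h : ∀ n : ℕ, a ^ 2 * q ^ n ≠ 1) (n : ℕ) : a * q ^ n ≠ 1 := by
  intro h0
  refine h (2 * n) ?_
  rw [mul_comm 2, pow_mul, ← mul_pow, h0, one_pow]

/-- The value of `f₂` is the same for all derived pairs: in the difference of the contributions of `a`
and `-a`, the ratios of infinite products with `a ^ 2` cancel. -/
theorem f2_eq (hq : ‖q‖ < 1) {a : ℂ} (ha : a ≠ 0) (haq : ∀ n : ℕ, a ^ 2 * q ^ n ≠ 1)
    {α β : ℂ → ℂ → ℕ → ℂ} {αs βs : ℂ → ℕ → ℂ}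
    (hpair : ∀ c ∈ ({a, -a} : Set ℂ),
      ∀ᶠ k in 𝓝[≠] (1 : ℂ), IsWPBaileyPair q c k (α c k) (β c k))
    (hd : ∀ c ∈ ({a, -a} : Set ℂ), IsDerivedPair α β c (αs c) (βs c))
    (hf : F2Converges αs βs a q) :
    f2 αs βs a q = -2 * oddLambert q a := by
  have h2 : ∀ n : ℕ, q * a ^ 2 * q ^ n ≠ 1 := fun n => by
    rw [mul_comm q, mul_assoc, ← pow_succ']
    exact haq (n + 1)
  have haq' : ∀ n : ℕ, (-a) ^ 2 * q ^ n ≠ 1 := fun n => by rw [neg_sq]; exact haq n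
  have h1 : ∀ n : ℕ, a * q * q ^ n ≠ 1 := fun n => by
    rw [mul_assoc, ← pow_succ']
    exact mul_pow_ne_one_of_sq haq _
  have h1' : ∀ n : ℕ, -a * q * q ^ n ≠ 1 := fun n => by
    rw [mul_assoc, ← pow_succ']
    exact mul_pow_ne_one_of_sq haq' _
  obtain ⟨hb, hb', hα', hα⟩ := hf
  have s1 := hasSum_betaTerm_sub_alphaTerm hq rfl ha h1 h2 (hpair a (by simp)) (hd a (by simp)) hb hα
  have s2 := hasSum_betaTerm_sub_alphaTerm hq (neg_sq a) (neg_ne_zero.2 ha) h1'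
    (by simpa using h2) (hpair (-a) (by simp)) (hd (-a) (by simp)) hb' hα'
  have s3 := (s1.sub s2).unique ((hasSum_qRatio_neg_sub hq h1 h1').congr_fun fun i => by ring)
  rw [f2, ← s3]
  ring

end Derived

/-! ### Partial fractions -/

section PartialFractions

open Polynomial in
/-- Partial fractions of `∏ (s - σ j) / (s - e j)`, normalised to vanish at a zero `t = σ k`. -/
lemma prod_sub_div_eq_sum {ι : Type*} [DecidableEq ι] (S : Finset ι) (e σ : ι → ℂ)
    (he : Set.InjOn e S) {s : ℂ} (hs : ∀ i ∈ S, s ≠ e i) {k : ι} (hk : k ∈ S)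
    (ht : ∀ i ∈ S, σ k ≠ e i) :
    ∏ j ∈ S, (s - σ j) / (s - e j) = ∑ i ∈ S, ((∏ j ∈ S, (e i - σ j)) /
      ∏ j ∈ S.erase i, (e i - e j)) * (1 / (s - e i) - 1 / (σ k - e i)) := by
  have hdeg : (Lagrange.nodal S σ - Lagrange.nodal S e).degree < S.card := by
    rw [← Lagrange.degree_nodal (s := S) (v := σ)]
    refine degree_sub_lt_left (by rw [Lagrange.degree_nodal, Lagrange.degree_nodal])
      Lagrange.nodal_ne_zero ?_
    rw [Lagrange.nodal_monic.leadingCoeff, Lagrange.nodal_monic.leadingCoeff]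
  have hint := Lagrange.eq_interpolate he hdeg
  have heval : ∀ x : ℂ, (∀ i ∈ S, x ≠ e i) →
      ∏ j ∈ S, (x - σ j) - ∏ j ∈ S, (x - e j) = (∏ j ∈ S, (x - e j)) * ∑ i ∈ S,
        ((∏ j ∈ S, (e i - σ j)) / ∏ j ∈ S.erase i, (e i - e j)) * (1 / (x - e i)) := by
    intro x hx
    have h := congrArg (Polynomial.eval x) hint
    rw [Lagrange.eval_interpolate_not_at_node _ hx, eval_sub, Lagrange.eval_nodal,
      Lagrange.eval_nodal] at h
    rw [h]
    congr 1
    refine Finset.sum_congr rfl fun i hi => ?_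
    rw [eval_sub, Lagrange.eval_nodal, Lagrange.eval_nodal_at_node hi, Lagrange.nodalWeight,
      Finset.prod_inv_distrib, sub_zero]
    ring
  have hne : ∀ x : ℂ, (∀ i ∈ S, x ≠ e i) → ∏ j ∈ S, (x - e j) ≠ 0 := fun x hx =>
    Finset.prod_ne_zero_iff.2 fun i hi => sub_ne_zero.2 (hx i hi)
  have h1 := heval s hs
  have h2 := heval (σ k) ht
  rw [Finset.prod_eq_zero hk (sub_self (σ k))] at h2
  have h3 : ∑ i ∈ S, ((∏ j ∈ S, (e i - σ j)) / ∏ j ∈ S.erase i, (e i - e j)) *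
      (1 / (σ k - e i)) = -1 := by
    have := hne _ ht
    refine mul_left_cancel₀ this ?_
    linear_combination -h2
  simp only [mul_sub, Finset.sum_sub_distrib]
  rw [h3, Finset.prod_div_distrib, div_eq_iff (hne s hs)]
  linear_combination h1

end PartialFractions

section Theta

variable {q : ℂ}

/-- The nodes `q ^ i - q ^ (-i)`, the poles of the theta quotient as a function of `a - a⁻¹`. -/
noncomputable def qNode (q : ℂ) (i : ℤ) : ℂ := q ^ i - q ^ (-i)

lemma qNode_zero (q : ℂ) : qNode q 0 = 0 := by simp [qNode]

lemma qNode_neg (q : ℂ) (i : ℤ) : qNode q (-i) = -qNode q i := by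
  rw [qNode, qNode, neg_neg, neg_sub]

lemma zpow_ne_neg_one (hq : ‖q‖ < 1) (hq0 : q ≠ 0) (i : ℤ) : q ^ i ≠ -1 := by
  intro h
  have h1 : ‖q‖ ^ i = ‖q‖ ^ (0 : ℤ) := by rw [← norm_zpow, h]; simp
  have h2 := (zpow_right_inj₀ (norm_pos_iff.2 hq0) hq.ne).1 h1
  rw [h2, zpow_zero] at h
  norm_num at h

lemma zpow_injective (hq : ‖q‖ < 1) (hq0 : q ≠ 0) : Function.Injective fun i : ℤ => q ^ i := by
  intro i j h
  refine (zpow_right_inj₀ (norm_pos_iff.2 hq0) hq.ne).1 ?_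
  rw [← norm_zpow, ← norm_zpow]
  exact congrArg norm h

lemma sub_sub_qNode (hq0 : q ≠ 0) {a : ℂ} (ha : a ≠ 0) (i : ℤ) :
    a - a⁻¹ - qNode q i = (a - q ^ i) * (1 + a⁻¹ * q ^ (-i)) := by
  have := zpow_ne_zero i hq0
  rw [qNode, zpow_neg]
  field_simp
  ring

lemma qNode_injective (hq : ‖q‖ < 1) (hq0 : q ≠ 0) : Function.Injective (qNode q) := by
  intro i j h
  have h1 := sub_sub_qNode hq0 (zpow_ne_zero i hq0) j
  have h2 : q ^ i - (q ^ i)⁻¹ - qNode q j = 0 := by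
    rw [← h, qNode, zpow_neg, sub_self]
  rw [h2] at h1
  rcases mul_eq_zero.1 h1.symm with h3 | h3
  · exact zpow_injective hq hq0 (sub_eq_zero.1 h3)
  · exfalso
    rw [← zpow_neg, ← zpow_add₀ hq0] at h3
    exact zpow_ne_neg_one hq hq0 _ (by linear_combination h3)

lemma sub_ne_qNode (hq0 : q ≠ 0) {a : ℂ} (ha : a ≠ 0)
    (haq : ∀ n : ℤ, a ^ 2 * q ^ n ≠ 1) (i : ℤ) : a - a⁻¹ ≠ qNode q i := by
  intro h
  have h1 := sub_sub_qNode hq0 ha i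
  rw [h, sub_self] at h1
  have hqi := zpow_ne_zero i hq0
  rcases mul_eq_zero.1 h1.symm with h3 | h3
  · refine haq (-(i + i)) ?_
    rw [sub_eq_zero.1 h3, neg_add, zpow_add₀ hq0, zpow_neg]
    field_simp
  · refine haq (i + i) ?_
    have h4 : a = -q ^ (-i) := by
      field_simp at h3
      linear_combination h3
    rw [h4, zpow_add₀ hq0, zpow_neg]
    field_simp

/-- The factors of the residues of the partial fraction expansion; the value at `m = 0` is `1`,
since there the denominator vanishes. -/
noncomputable def residueFactor (q t : ℂ) (m : ℤ) : ℂ := 1 + t / qNode q m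

lemma residueFactor_eq (hq : ‖q‖ < 1) (hq0 : q ≠ 0) {b : ℂ} (hb : b ≠ 0) {i j : ℤ} (hij : j ≠ i) :
    residueFactor q (b - b⁻¹) (j - i) = (q ^ i - b * q ^ j) * (1 + b⁻¹ * q ^ (j - i)) /
      ((q ^ i - q ^ j) * (1 + q ^ (j - i))) := by
  have hi := zpow_ne_zero i hq0
  have hj := zpow_ne_zero j hq0
  have hE : qNode q (j - i) ≠ 0 := fun h => hij (sub_eq_zero.1
    (qNode_injective hq hq0 (h.trans (qNode_zero q).symm)))
  have h1 : (q ^ i - q ^ j) * (1 + q ^ (j - i)) = -q ^ j * qNode q (j - i) := by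
    rw [qNode, zpow_neg, zpow_sub₀ hq0]
    field_simp
    ring
  rw [h1, residueFactor, eq_div_iff (mul_ne_zero (neg_ne_zero.2 hj) hE)]
  have h2 : (1 + (b - b⁻¹) / qNode q (j - i)) * (-q ^ j * qNode q (j - i)) =
      -q ^ j * qNode q (j - i) - q ^ j * (b - b⁻¹) := by
    field_simp
    ring
  rw [h2, qNode, zpow_neg, zpow_sub₀ hq0]
  field_simp
  ring

lemma prod_Icc_comp_neg (f : ℤ → ℂ) (N : ℕ) :
    ∏ j ∈ Finset.Icc (-N : ℤ) N, f (-j) = ∏ j ∈ Finset.Icc (-N : ℤ) N, f j := by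
  refine Finset.prod_nbij' (fun j => -j) (fun j => -j) ?_ ?_ ?_ ?_ ?_
  all_goals intro j hj
  all_goals simp only [Finset.mem_Icc, neg_neg] at *
  all_goals omega

/-- The residues of the truncated theta quotient `∏ (s - σ j) / (s - e j)`. -/
lemma residue_eq (hq : ‖q‖ < 1) (hq0 : q ≠ 0) {b : ℂ} (hb : b ≠ 0) {N : ℕ} {i : ℤ}
    (hi : i ∈ Finset.Icc (-N : ℤ) N) :
    (∏ j ∈ Finset.Icc (-N : ℤ) N, (qNode q i - (b * q ^ j - (b * q ^ j)⁻¹))) /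
      ∏ j ∈ (Finset.Icc (-N : ℤ) N).erase i, (qNode q i - qNode q j) =
    -(b - b⁻¹) * ((q ^ i + q ^ (-i)) / 2) *
      ∏ j ∈ Finset.Icc (-N : ℤ) N, residueFactor q (b - b⁻¹) (j - i) := by
  set S := Finset.Icc (-N : ℤ) N with hS
  have hz : ∀ m : ℤ, q ^ m ≠ 0 := fun m => zpow_ne_zero m hq0
  have hone : ∀ m : ℤ, 1 + q ^ m ≠ 0 := fun m h =>
    zpow_ne_neg_one hq hq0 m (by linear_combination h)
  have hnum : ∏ j ∈ S, (qNode q i - (b * q ^ j - (b * q ^ j)⁻¹)) =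
      ∏ j ∈ S, ((q ^ i - b * q ^ j) * (1 + b⁻¹ * q ^ (j - i))) := by
    rw [Finset.prod_mul_distrib, ← prod_Icc_comp_neg (fun j => 1 + b⁻¹ * q ^ (j - i)),
      ← Finset.prod_mul_distrib]
    refine Finset.prod_congr rfl fun j _ => ?_
    have := hz i
    have := hz j
    rw [qNode, zpow_neg, zpow_sub₀ hq0, zpow_neg]
    field_simp
    ring
  have hden : (∏ j ∈ S.erase i, (qNode q i - qNode q j)) * (1 + q ^ (-i - i)) =
      2 * ∏ j ∈ S.erase i, ((q ^ i - q ^ j) * (1 + q ^ (j - i))) := by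
    have h1 : ∏ j ∈ S.erase i, (qNode q i - qNode q j) =
        ∏ j ∈ S.erase i, ((q ^ i - q ^ j) * (1 + q ^ (-j - i))) := by
      refine Finset.prod_congr rfl fun j _ => ?_
      have := hz i
      have := hz j
      rw [qNode, qNode, zpow_neg, zpow_neg, zpow_sub₀ hq0, zpow_neg]
      field_simp
      ring
    have h2 : (1 + q ^ (-i - i)) * ∏ j ∈ S.erase i, (1 + q ^ (-j - i)) =
        2 * ∏ j ∈ S.erase i, (1 + q ^ (j - i)) := by
      rw [Finset.mul_prod_erase S (fun j => 1 + q ^ (-j - i)) hi,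
        prod_Icc_comp_neg (fun j => 1 + q ^ (j - i)),
        ← Finset.mul_prod_erase S (fun j => 1 + q ^ (j - i)) hi, sub_self, zpow_zero]
      norm_num
    rw [h1, Finset.prod_mul_distrib, Finset.prod_mul_distrib]
    linear_combination (∏ j ∈ S.erase i, (q ^ i - q ^ j)) * h2
  have hD : ∏ j ∈ S.erase i, ((q ^ i - q ^ j) * (1 + q ^ (j - i))) ≠ 0 :=
    Finset.prod_ne_zero_iff.2 fun j hj => mul_ne_zero
      (sub_ne_zero.2 fun h => (Finset.ne_of_mem_erase hj) (zpow_injective hq hq0 h.symm)) (hone _)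
  have hD' : ∏ j ∈ S.erase i, (qNode q i - qNode q j) ≠ 0 :=
    Finset.prod_ne_zero_iff.2 fun j hj =>
      sub_ne_zero.2 fun h => (Finset.ne_of_mem_erase hj) (qNode_injective hq hq0 h.symm)
  have hres : ∏ j ∈ S, residueFactor q (b - b⁻¹) (j - i) =
      (∏ j ∈ S.erase i, ((q ^ i - b * q ^ j) * (1 + b⁻¹ * q ^ (j - i)))) /
        ∏ j ∈ S.erase i, ((q ^ i - q ^ j) * (1 + q ^ (j - i))) := by
    rw [← Finset.mul_prod_erase S _ hi, sub_self, residueFactor, qNode_zero, div_zero, add_zero,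
      one_mul, ← Finset.prod_div_distrib]
    exact Finset.prod_congr rfl fun j hj => residueFactor_eq hq hq0 hb (Finset.ne_of_mem_erase hj)
  rw [hres, hnum, ← Finset.mul_prod_erase S _ hi, div_eq_iff hD', sub_self, zpow_zero, mul_one]
  generalize ∏ j ∈ S.erase i, ((q ^ i - b * q ^ j) * (1 + b⁻¹ * q ^ (j - i))) = A
  generalize ∏ j ∈ S.erase i, ((q ^ i - q ^ j) * (1 + q ^ (j - i))) = D at hden hD ⊢
  generalize ∏ j ∈ S.erase i, (qNode q i - qNode q j) = D' at hden ⊢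
  have h1 : q ^ i + q ^ (-i) = q ^ i * (1 + q ^ (-i - i)) := by
    have := hz i
    rw [zpow_sub₀ hq0, zpow_neg]
    field_simp
  have h2 : (q ^ i - b * q ^ i) * (1 + b⁻¹) = -(b - b⁻¹) * q ^ i := by
    field_simp
    ring
  rw [h2, h1]
  calc _ = -(b - b⁻¹) * (q ^ i / 2) * (A / D) * (2 * D) := by field_simp
    _ = _ := by rw [← hden]; ring

lemma prod_Icc_eq_prod_range (f : ℤ → ℂ) (N : ℕ) :
    ∏ j ∈ Finset.Icc (-N : ℤ) N, f j =
      f 0 * ∏ m ∈ Finset.range N, (f (m + 1) * f (-(m + 1))) := by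
  induction N with
  | zero => simp
  | succ N ih =>
    have h : Finset.Icc (-(N + 1 : ℕ) : ℤ) (N + 1 : ℕ) =
        insert (N + 1 : ℤ) (insert (-(N + 1) : ℤ) (Finset.Icc (-N : ℤ) N)) := by
      ext j
      simp only [Finset.mem_insert, Finset.mem_Icc]
      omega
    rw [h, Finset.prod_insert, Finset.prod_insert, ih, Finset.prod_range_succ]
    · ring
    · simp
    · simp only [Finset.mem_insert, Finset.mem_Icc]
      omega

end Theta

/-! ### The bilateral Lambert series as a theta quotient -/

section ThetaLimit

variable {q : ℂ}

lemma summable_pow_mul_of_tendsto (hq : ‖q‖ < 1) {B : ℕ → ℂ} {l : ℂ}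
    (hB : Tendsto B atTop (𝓝 l)) : Summable fun n => q ^ n * B n := by
  obtain ⟨C, hC⟩ := exists_norm_le_of_tendsto hB
  refine Summable.of_norm_bounded
    ((summable_geometric_of_lt_one (norm_nonneg q) hq).mul_left C) fun n => ?_
  rw [norm_mul, norm_pow, mul_comm]
  gcongr
  exact hC n

lemma tendsto_pow_succ_zero (hq : ‖q‖ < 1) : Tendsto (fun n : ℕ => q ^ (n + 1)) atTop (𝓝 0) :=
  (tendsto_pow_atTop_nhds_zero_of_norm_lt_one hq).comp (tendsto_add_atTop_nat 1)

lemma summable_pow_mul_of_continuousAt (hq : ‖q‖ < 1) {F : ℂ → ℂ} (hF : ContinuousAt F 0) :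
    Summable fun n : ℕ => q ^ (n + 1) * F (q ^ (n + 1)) := by
  have h := summable_pow_mul_of_tendsto hq
    ((hF.tendsto.comp (tendsto_pow_succ_zero hq)).const_mul q)
  refine h.congr fun n => ?_
  rw [Function.comp_apply, pow_succ]
  ring

lemma summable_oddLambert (hq : ‖q‖ < 1) (c : ℂ) :
    Summable fun n : ℕ => c * q ^ (n + 1) / (1 - c ^ 2 * (q ^ (n + 1)) ^ 2) := by
  have hF : ContinuousAt (fun x : ℂ => c / (1 - c ^ 2 * x ^ 2)) 0 :=
    ContinuousAt.div (by fun_prop) (by fun_prop) (by simp)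
  refine (summable_pow_mul_of_continuousAt hq hF).congr fun n => ?_
  ring

lemma zpow_cast_succ (q : ℂ) (m : ℕ) : q ^ ((m : ℤ) + 1) = q ^ (m + 1) := by
  exact_mod_cast zpow_natCast q (m + 1)

lemma zpow_neg_cast_succ (q : ℂ) (m : ℕ) : q ^ (-((m : ℤ) + 1)) = (q ^ (m + 1))⁻¹ := by
  rw [zpow_neg, zpow_cast_succ]

lemma qNode_cast_succ (q : ℂ) (m : ℕ) :
    qNode q ((m : ℤ) + 1) = q ^ (m + 1) - (q ^ (m + 1))⁻¹ := by
  rw [qNode, zpow_neg_cast_succ, zpow_cast_succ]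

lemma summable_div_qNode (hq : ‖q‖ < 1) (hq0 : q ≠ 0) (t : ℂ) :
    Summable fun m : ℤ => t / qNode q m := by
  have h1 : Summable fun m : ℕ => t / qNode q ((m : ℤ) + 1) := by
    have hF : ContinuousAt (fun x : ℂ => t / (x ^ 2 - 1)) 0 :=
      ContinuousAt.div (by fun_prop) (by fun_prop) (by simp)
    refine (summable_pow_mul_of_continuousAt hq hF).congr fun n => ?_
    have hx : q ^ (n + 1) ≠ 0 := pow_ne_zero _ hq0
    rw [qNode_cast_succ]
    generalize q ^ (n + 1) = x at hx ⊢
    rw [show x - x⁻¹ = (x ^ 2 - 1) / x by field_simp]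
    rw [div_div_eq_mul_div]
    ring
  refine Summable.of_add_one_of_neg_add_one h1 (h1.neg.congr fun m => ?_)
  rw [qNode_neg, div_neg]

lemma hasProd_residueFactor (hq : ‖q‖ < 1) (hq0 : q ≠ 0) (t : ℂ) :
    HasProd (residueFactor q t) (∏' m, residueFactor q t m) :=
  (multipliable_one_add_of_summable (summable_div_qNode hq hq0 t).norm).hasProd

lemma tendsto_Icc_neg_cast : Tendsto (fun N : ℕ => Finset.Icc (-N : ℤ) N) atTop atTop := by
  refine tendsto_atTop_finset_of_monotone (fun m n h j hj => ?_) fun j => ⟨j.natAbs, ?_⟩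
  · simp only [Finset.mem_Icc] at hj ⊢
    omega
  · simp only [Finset.mem_Icc]
    omega

lemma tendsto_prod_residueFactor (hq : ‖q‖ < 1) (hq0 : q ≠ 0) (t : ℂ) (i : ℤ) :
    Tendsto (fun N : ℕ => ∏ j ∈ Finset.Icc (-N : ℤ) N, residueFactor q t (j - i)) atTop
      (𝓝 (∏' m, residueFactor q t m)) := by
  have h := (Equiv.subRight i).hasProd_iff.2 (hasProd_residueFactor hq hq0 t)
  rw [HasProd, SummationFilter.unconditional_filter] at h
  exact h.comp tendsto_Icc_neg_cast

lemma norm_prod_residueFactor_le (hq : ‖q‖ < 1) (hq0 : q ≠ 0) (t : ℂ) (S : Finset ℤ) (i : ℤ) :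
    ‖∏ j ∈ S, residueFactor q t (j - i)‖ ≤ Real.exp (∑' m : ℤ, ‖t / qNode q m‖) := by
  have h := S.norm_prod_one_add_sub_one_le fun j => t / qNode q (j - i)
  have hs := (Equiv.subRight i).summable_iff.2 (summable_div_qNode hq hq0 t).norm
  have h2 : ∑ j ∈ S, ‖t / qNode q (j - i)‖ ≤ ∑' m : ℤ, ‖t / qNode q m‖ := by
    rw [← (Equiv.subRight i).tsum_eq]
    exact hs.sum_le_tsum S fun _ _ => norm_nonneg _
  have h3 := Real.exp_le_exp.2 h2
  have h4 := norm_sub_norm_le (∏ j ∈ S, residueFactor q t (j - i)) 1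
  rw [norm_one] at h4
  have h5 : ‖∏ j ∈ S, residueFactor q t (j - i) - 1‖ ≤ _ := h
  linarith

/-- The terms `(q ^ i + q ^ (-i)) / 2 * (1 / (s - e i) - 1 / (t - e i))` of the expansion of the
theta quotient, where `s = a - a⁻¹` and `t = b - b⁻¹`. -/
noncomputable def polarTerm (q a b : ℂ) (i : ℤ) : ℂ :=
  (q ^ i + q ^ (-i)) / 2 * (1 / (a - a⁻¹ - qNode q i) - 1 / (b - b⁻¹ - qNode q i))

lemma polarTerm_neg (q a b : ℂ) (i : ℤ) : polarTerm q a b (-i) = -polarTerm q (-a) (-b) i := by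
  have h : ∀ c : ℂ, -c - (-c)⁻¹ - qNode q i = -(c - c⁻¹ - qNode q (-i)) := fun c => by
    rw [qNode_neg, inv_neg]
    ring
  rw [polarTerm, polarTerm, h, h, neg_neg, one_div_neg_eq_neg_one_div, one_div_neg_eq_neg_one_div]
  ring

lemma summable_polarTerm_nat (hq : ‖q‖ < 1) (hq0 : q ≠ 0) {a b : ℂ} (ha : a ≠ 0) (hb : b ≠ 0)
    (haq : ∀ n : ℤ, a ^ 2 * q ^ n ≠ 1) (hbq : ∀ n : ℤ, b ^ 2 * q ^ n ≠ 1) :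
    Summable fun n : ℕ => polarTerm q a b (n + 1) := by
  have hF : ContinuousAt (fun x : ℂ => (x ^ 2 + 1) * ((b - b⁻¹) - (a - a⁻¹)) /
      (2 * ((a - x) * (x + a⁻¹)) * ((b - x) * (x + b⁻¹)))) 0 :=
    ContinuousAt.div (by fun_prop) (by fun_prop) (by simp [ha, hb])
  refine (summable_pow_mul_of_continuousAt hq hF).congr fun n => ?_
  have hx : q ^ (n + 1) ≠ 0 := pow_ne_zero _ hq0
  have ha' := sub_ne_zero.2 (sub_ne_qNode hq0 ha haq (n + 1))
  have hb' := sub_ne_zero.2 (sub_ne_qNode hq0 hb hbq (n + 1))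
  rw [polarTerm, div_sub_div _ _ ha' hb', one_mul, mul_one]
  have e : ∀ {c : ℂ}, c ≠ 0 → c - c⁻¹ - qNode q (n + 1) =
      (c - q ^ (n + 1)) * (q ^ (n + 1) + c⁻¹) / q ^ (n + 1) := fun {c} hc => by
    rw [sub_sub_qNode hq0 hc, zpow_neg_cast_succ, zpow_cast_succ]
    field_simp
  have e3 : b - b⁻¹ - qNode q (n + 1) - (a - a⁻¹ - qNode q (n + 1)) =
      (b - b⁻¹) - (a - a⁻¹) := by ring
  rw [e3]
  rw [e ha] at ha' ⊢
  rw [e hb] at hb' ⊢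
  rw [zpow_neg_cast_succ, zpow_cast_succ]
  generalize b - b⁻¹ - (a - a⁻¹) = d
  generalize q ^ (n + 1) = x at hx ha' hb' ⊢
  have h1 : (a - x) * (x + a⁻¹) ≠ 0 := fun h => ha' (by rw [h, zero_div])
  have h2 : (b - x) * (x + b⁻¹) ≠ 0 := fun h => hb' (by rw [h, zero_div])
  generalize (a - x) * (x + a⁻¹) = y at h1 ⊢
  generalize (b - x) * (x + b⁻¹) = z at h2 ⊢
  field_simp

lemma summable_polarTerm (hq : ‖q‖ < 1) (hq0 : q ≠ 0) {a b : ℂ} (ha : a ≠ 0) (hb : b ≠ 0)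
    (haq : ∀ n : ℤ, a ^ 2 * q ^ n ≠ 1) (hbq : ∀ n : ℤ, b ^ 2 * q ^ n ≠ 1) :
    Summable (polarTerm q a b) := by
  refine Summable.of_add_one_of_neg_add_one (summable_polarTerm_nat hq hq0 ha hb haq hbq) ?_
  refine (summable_polarTerm_nat hq hq0 (neg_ne_zero.2 ha) (neg_ne_zero.2 hb)
    (by simpa using haq) (by simpa using hbq)).neg.congr fun n => ?_
  rw [polarTerm_neg]

lemma polar_pair_eq (hq0 : q ≠ 0) {a : ℂ} (ha : a ≠ 0) (haq : ∀ n : ℤ, a ^ 2 * q ^ n ≠ 1) (n : ℕ) :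
    (q ^ ((n : ℤ) + 1) + q ^ (-((n : ℤ) + 1))) / 2 *
      (1 / (a - a⁻¹ - qNode q (n + 1)) + 1 / (a - a⁻¹ + qNode q (n + 1))) =
    a⁻¹ * q ^ (n + 1) / (1 - a⁻¹ ^ 2 * (q ^ (n + 1)) ^ 2) -
      a * q ^ (n + 1) / (1 - a ^ 2 * (q ^ (n + 1)) ^ 2) := by
  have hx : q ^ (n + 1) ≠ 0 := pow_ne_zero _ hq0
  have h1 := sub_ne_zero.2 (sub_ne_qNode hq0 ha haq (n + 1))
  have h2 := sub_ne_zero.2 (sub_ne_qNode hq0 ha haq (-(n + 1)))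
  rw [qNode_neg, sub_neg_eq_add] at h2
  have h3 := haq ((2 * (n + 1) : ℕ) : ℤ)
  have h4 := haq (-((2 * (n + 1) : ℕ) : ℤ))
  rw [zpow_neg] at h4
  rw [zpow_natCast, mul_comm 2, pow_mul] at h3 h4
  rw [qNode_cast_succ] at h1 h2 ⊢
  rw [zpow_neg_cast_succ, zpow_cast_succ]
  generalize q ^ (n + 1) = x at *
  have h3' : 1 - a ^ 2 * x ^ 2 ≠ 0 := sub_ne_zero.2 h3.symm
  have h4' : a ^ 2 - x ^ 2 ≠ 0 := fun h => h4 (by rw [sub_eq_zero.1 h]; field_simp)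
  have e1 : 1 - a⁻¹ ^ 2 * x ^ 2 = (a ^ 2 - x ^ 2) / a ^ 2 := by field_simp
  have e2 : 1 / (a - a⁻¹ - (x - x⁻¹)) + 1 / (a - a⁻¹ + (x - x⁻¹)) =
      2 * (a - a⁻¹) / ((a - a⁻¹ - (x - x⁻¹)) * (a - a⁻¹ + (x - x⁻¹))) := by
    generalize a - a⁻¹ = s at h1 h2 ⊢
    generalize x - x⁻¹ = y at h1 h2 ⊢
    field_simp
    ring
  have e3 : (a - a⁻¹ - (x - x⁻¹)) * (a - a⁻¹ + (x - x⁻¹)) =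
      -((1 - a ^ 2 * x ^ 2) * (a ^ 2 - x ^ 2)) / (a ^ 2 * x ^ 2) := by
    field_simp
    ring
  rw [e2, e3, e1]
  rw [mul_comm (a ^ 2) (x ^ 2)] at h3' ⊢
  field_simp
  ring

/-- Pairing the terms at `i` and `-i` turns the sum over the nodes into Lambert series. -/
lemma tsum_polarTerm (hq : ‖q‖ < 1) (hq0 : q ≠ 0) {a b : ℂ} (ha : a ≠ 0) (hb : b ≠ 0)
    (haq : ∀ n : ℤ, a ^ 2 * q ^ n ≠ 1) (hbq : ∀ n : ℤ, b ^ 2 * q ^ n ≠ 1) :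
    ∑' i, polarTerm q a b i = 1 / (a - a⁻¹) - 1 / (b - b⁻¹) -
      (oddLambert q a - oddLambert q a⁻¹) + (oddLambert q b - oddLambert q b⁻¹) := by
  have s1 := summable_polarTerm_nat hq hq0 ha hb haq hbq
  have s2 : Summable fun n : ℕ => polarTerm q a b (-((n : ℤ) + 1)) :=
    (summable_polarTerm_nat hq hq0 (neg_ne_zero.2 ha) (neg_ne_zero.2 hb)
      (by simpa using haq) (by simpa using hbq)).neg.congr fun n => by rw [polarTerm_neg]
  have hz : polarTerm q a b 0 = 1 / (a - a⁻¹) - 1 / (b - b⁻¹) := by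
    rw [polarTerm, qNode_zero]
    norm_num
  have hL := fun c => summable_oddLambert hq c
  have e : ∑' n : ℕ, polarTerm q a b (n + 1) + ∑' n : ℕ, polarTerm q a b (-((n : ℤ) + 1)) =
      (oddLambert q a⁻¹ - oddLambert q a) - (oddLambert q b⁻¹ - oddLambert q b) := by
    rw [← s1.tsum_add s2, oddLambert, oddLambert, oddLambert, oddLambert,
      ← (hL _).tsum_sub (hL _), ← (hL _).tsum_sub (hL _),
      ← ((hL _).sub (hL _)).tsum_sub ((hL _).sub (hL _))]
    refine tsum_congr fun n => ?_
    rw [← polar_pair_eq hq0 ha haq n, ← polar_pair_eq hq0 hb hbq n, polarTerm, polarTerm, qNode_neg,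
      neg_neg]
    ring
  rw [tsum_of_add_one_of_neg_add_one s1 s2, hz]
  linear_combination e

/-- The truncated theta quotient converges to its partial fraction expansion. -/
lemma tendsto_truncated_theta (hq : ‖q‖ < 1) (hq0 : q ≠ 0) {a b : ℂ} (ha : a ≠ 0) (hb : b ≠ 0)
    (haq : ∀ n : ℤ, a ^ 2 * q ^ n ≠ 1) (hbq : ∀ n : ℤ, b ^ 2 * q ^ n ≠ 1) :
    Tendsto (fun N : ℕ => ∏ j ∈ Finset.Icc (-N : ℤ) N,
      (a - a⁻¹ - (b * q ^ j - (b * q ^ j)⁻¹)) / (a - a⁻¹ - qNode q j)) atTop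
      (𝓝 (∑' i, -(b - b⁻¹) * (∏' m, residueFactor q (b - b⁻¹) m) * polarTerm q a b i)) := by
  have hlim : Tendsto (fun N : ℕ => ∑' i : ℤ, (Finset.Icc (-N : ℤ) N : Set ℤ).indicator
      (fun i => -(b - b⁻¹) * (∏ j ∈ Finset.Icc (-N : ℤ) N, residueFactor q (b - b⁻¹) (j - i)) *
        polarTerm q a b i) i) atTop
      (𝓝 (∑' i, -(b - b⁻¹) * (∏' m, residueFactor q (b - b⁻¹) m) * polarTerm q a b i)) := by
    refine tendsto_tsum_of_dominated_convergence (bound := fun i => ‖b - b⁻¹‖ *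
      Real.exp (∑' m : ℤ, ‖(b - b⁻¹) / qNode q m‖) * ‖polarTerm q a b i‖)
      ((summable_polarTerm hq hq0 ha hb haq hbq).norm.mul_left _) (fun i => ?_)
      (Eventually.of_forall fun N i => ?_)
    · refine (((tendsto_prod_residueFactor hq hq0 (b - b⁻¹) i).const_mul
        (-(b - b⁻¹))).mul_const (polarTerm q a b i)).congr' ?_
      filter_upwards [eventually_ge_atTop i.natAbs] with N hN
      rw [Set.indicator_of_mem]
      simp only [Finset.coe_Icc, Set.mem_Icc]
      omega
    · refine (norm_indicator_le_norm_self _ _).trans ?_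
      rw [norm_mul, norm_mul, norm_neg]
      gcongr
      exact norm_prod_residueFactor_le hq hq0 _ _ _
  refine hlim.congr fun N => ?_
  have hfrac := prod_sub_div_eq_sum (Finset.Icc (-N : ℤ) N) (qNode q)
    (fun j => b * q ^ j - (b * q ^ j)⁻¹) (qNode_injective hq hq0).injOn
    (fun i _ => sub_ne_qNode hq0 ha haq i) (k := 0) (by simp)
    (fun i _ => by simpa using sub_ne_qNode hq0 hb hbq i)
  rw [hfrac, tsum_eq_sum (s := Finset.Icc (-N : ℤ) N) fun i hi =>
    Set.indicator_of_notMem (by simpa using hi) _]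
  refine Finset.sum_congr rfl fun i hi => ?_
  rw [Set.indicator_of_mem (by simpa using hi), residue_eq hq hq0 hb hi, polarTerm]
  simp only [zpow_zero, mul_one]
  ring

lemma pow_pow_swap (q : ℂ) (m : ℕ) : (q ^ 2) ^ m = (q ^ m) ^ 2 := by
  rw [← pow_mul, ← pow_mul, mul_comm]

lemma truncated_theta_eq (hq0 : q ≠ 0) {a b : ℂ} (ha : a ≠ 0) (hb : b ≠ 0) (N : ℕ) :
    ∏ j ∈ Finset.Icc (-N : ℤ) N,
      (a - a⁻¹ - (b * q ^ j - (b * q ^ j)⁻¹)) / (a - a⁻¹ - qNode q j) =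
    (a - a⁻¹ - (b - b⁻¹)) / (a - a⁻¹) *
      (qPoch (b / a * q) q N * qPoch (q * a / b) q N * qPoch (-(a * b) * q) q N *
        qPoch (-(q / (a * b))) q N /
        (qPoch (a ^ 2 * q ^ 2) (q ^ 2) N * qPoch (q ^ 2 / a ^ 2) (q ^ 2) N)) := by
  rw [prod_Icc_eq_prod_range, qNode_zero, zpow_zero, mul_one, sub_zero]
  congr 1
  simp only [qPoch, ← Finset.prod_mul_distrib, ← Finset.prod_div_distrib]
  refine Finset.prod_congr rfl fun m _ => ?_
  have hx : q ^ (m + 1) ≠ 0 := pow_ne_zero _ hq0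
  rw [qNode_neg, qNode_cast_succ, zpow_neg_cast_succ, zpow_cast_succ]
  have e1 : b / a * q * q ^ m = b / a * q ^ (m + 1) := by ring
  have e2 : q * a / b * q ^ m = a / b * q ^ (m + 1) := by ring
  have e3 : -(a * b) * q * q ^ m = -(a * b) * q ^ (m + 1) := by ring
  have e4 : -(q / (a * b)) * q ^ m = -(q ^ (m + 1) / (a * b)) := by ring
  have e5 : a ^ 2 * q ^ 2 * (q ^ 2) ^ m = a ^ 2 * (q ^ (m + 1)) ^ 2 := by
    rw [pow_pow_swap]; ring
  have e6 : q ^ 2 / a ^ 2 * (q ^ 2) ^ m = (q ^ (m + 1)) ^ 2 / a ^ 2 := by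
    rw [pow_pow_swap]; ring
  rw [e1, e2, e3, e4, e5, e6]
  generalize q ^ (m + 1) = x at hx ⊢
  have n1 : (a - a⁻¹ - (b * x - (b * x)⁻¹)) * (a - a⁻¹ - (b * x⁻¹ - (b * x⁻¹)⁻¹)) =
      -(x ^ 2)⁻¹ * ((1 - b / a * x) * (1 - a / b * x) * (1 - -(a * b) * x) *
        (1 - -(x / (a * b)))) := by
    field_simp
    ring
  have n2 : (a - a⁻¹ - (x - x⁻¹)) * (a - a⁻¹ - -(x - x⁻¹)) =
      -(x ^ 2)⁻¹ * ((1 - a ^ 2 * x ^ 2) * (1 - x ^ 2 / a ^ 2)) := by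
    field_simp
    ring
  rw [div_mul_div_comm, n1, n2, mul_div_mul_left]
  exact neg_ne_zero.2 (inv_ne_zero (pow_ne_zero 2 hx))

lemma truncated_residue_eq (hq : ‖q‖ < 1) (hq0 : q ≠ 0) {b : ℂ} (hb : b ≠ 0) (N : ℕ) :
    ∏ j ∈ Finset.Icc (-N : ℤ) N, residueFactor q (b - b⁻¹) (j - 0) =
      qPoch (b ^ 2 * q ^ 2) (q ^ 2) N * qPoch (q ^ 2 / b ^ 2) (q ^ 2) N /
        qPoch (q ^ 2) (q ^ 2) N ^ 2 := by
  simp only [sub_zero]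
  rw [prod_Icc_eq_prod_range, residueFactor, qNode_zero, div_zero, add_zero, one_mul]
  simp only [qPoch, sq (∏ i ∈ _, _), ← Finset.prod_mul_distrib, ← Finset.prod_div_distrib]
  refine Finset.prod_congr rfl fun m _ => ?_
  have hx : q ^ (m + 1) ≠ 0 := pow_ne_zero _ hq0
  have hE : qNode q ((m : ℤ) + 1) ≠ 0 := fun h => by
    have := qNode_injective hq hq0 (h.trans (qNode_zero q).symm)
    omega
  rw [residueFactor, residueFactor, qNode_neg]
  rw [qNode_cast_succ] at hE ⊢
  have e1 : q ^ 2 * (q ^ 2) ^ m = (q ^ (m + 1)) ^ 2 := by rw [pow_pow_swap]; ring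
  have e2 : b ^ 2 * q ^ 2 * (q ^ 2) ^ m = b ^ 2 * (q ^ (m + 1)) ^ 2 := by rw [mul_assoc, e1]
  have e3 : q ^ 2 / b ^ 2 * (q ^ 2) ^ m = (q ^ (m + 1)) ^ 2 / b ^ 2 := by
    rw [div_mul_eq_mul_div, e1]
  rw [e1, e2, e3]
  generalize q ^ (m + 1) = x at hx hE ⊢
  have h1 : x - x⁻¹ = -(1 - x ^ 2) / x := by
    field_simp
    ring
  have h2 : 1 - x ^ 2 ≠ 0 := fun h => hE (by rw [h1, h]; simp)
  rw [h1]
  field_simp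
  ring

lemma norm_sq_lt_one (hq : ‖q‖ < 1) : ‖q ^ 2‖ < 1 := by
  rw [norm_pow]
  exact pow_lt_one₀ (norm_nonneg q) hq two_ne_zero

lemma sq_mul_sq_pow_ne_one {a : ℂ} (haq : ∀ n : ℤ, a ^ 2 * q ^ n ≠ 1) (n : ℕ) :
    a ^ 2 * q ^ 2 * (q ^ 2) ^ n ≠ 1 := by
  have h := haq ((2 * (n + 1) : ℕ) : ℤ)
  rwa [zpow_natCast, pow_mul, pow_succ' (q ^ 2), ← mul_assoc] at h

lemma sq_div_sq_pow_ne_one {a : ℂ} (ha : a ≠ 0) (haq : ∀ n : ℤ, a ^ 2 * q ^ n ≠ 1) (n : ℕ) :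
    q ^ 2 / a ^ 2 * (q ^ 2) ^ n ≠ 1 := by
  intro h
  have h1 : q ^ (2 * (n + 1)) = a ^ 2 := by
    rw [pow_mul, pow_succ', ← div_eq_one_iff_eq (pow_ne_zero 2 ha), ← h]
    ring
  refine haq (-((2 * (n + 1) : ℕ) : ℤ)) ?_
  rw [zpow_neg, zpow_natCast, h1, mul_inv_cancel₀ (pow_ne_zero 2 ha)]

/-- The limit of the truncated partial fraction expansion: the product side is the limit of the
truncations, the constant in front of the sum is the limit of the residue at the node `0`. -/
lemma theta_sub_of_ne_zero (hq : ‖q‖ < 1) (hq0 : q ≠ 0) {a b : ℂ} (ha : a ≠ 0) (hb : b ≠ 0)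
    (haq : ∀ n : ℤ, a ^ 2 * q ^ n ≠ 1) (hbq : ∀ n : ℤ, b ^ 2 * q ^ n ≠ 1) :
    (a - a⁻¹ - (b - b⁻¹)) / (a - a⁻¹) *
      (qPochInf (b / a * q) q * qPochInf (q * a / b) q * qPochInf (-(a * b) * q) q *
        qPochInf (-(q / (a * b))) q /
        (qPochInf (a ^ 2 * q ^ 2) (q ^ 2) * qPochInf (q ^ 2 / a ^ 2) (q ^ 2))) =
      -(b - b⁻¹) * (qPochInf (b ^ 2 * q ^ 2) (q ^ 2) * qPochInf (q ^ 2 / b ^ 2) (q ^ 2) /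
        qPochInf (q ^ 2) (q ^ 2) ^ 2) * ∑' i, polarTerm q a b i := by
  have hQ := norm_sq_lt_one hq
  have h1 := tendsto_truncated_theta hq hq0 ha hb haq hbq
  simp only [truncated_theta_eq hq0 ha hb] at h1
  have h2 := tendsto_prod_residueFactor hq hq0 (b - b⁻¹) 0
  simp only [truncated_residue_eq hq hq0 hb] at h2
  have h3 := tendsto_nhds_unique h2 (((tendsto_qPoch hQ _).mul (tendsto_qPoch hQ _)).div
    ((tendsto_qPoch hQ _).pow 2) (pow_ne_zero 2 (qPochInf_ne_zero hQ (self_mul_pow_ne_one hQ))))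
  rw [tsum_mul_left, h3] at h1
  refine tendsto_nhds_unique (Tendsto.const_mul _ (Tendsto.div ?_ ?_ ?_)) h1
  · exact (((tendsto_qPoch hq _).mul (tendsto_qPoch hq _)).mul (tendsto_qPoch hq _)).mul
      (tendsto_qPoch hq _)
  · exact (tendsto_qPoch hQ _).mul (tendsto_qPoch hQ _)
  · exact mul_ne_zero (qPochInf_ne_zero hQ (sq_mul_sq_pow_ne_one haq))
      (qPochInf_ne_zero hQ (sq_div_sq_pow_ne_one ha haq))

lemma one_sub_sq_ne_zero {a : ℂ} (haq : ∀ n : ℤ, a ^ 2 * q ^ n ≠ 1) : 1 - a ^ 2 ≠ 0 := by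
  have h := haq 0
  rw [zpow_zero, mul_one] at h
  exact sub_ne_zero.2 h.symm

/-- The difference of two bilateral Lambert series is a quotient of theta functions. -/
theorem lambert_sub_eq_theta (hq : ‖q‖ < 1) {a b : ℂ} (ha : a ≠ 0) (hb : b ≠ 0)
    (haq : ∀ n : ℤ, a ^ 2 * q ^ n ≠ 1) (hbq : ∀ n : ℤ, b ^ 2 * q ^ n ≠ 1) :
    (a / (1 - a ^ 2) + (oddLambert q a - oddLambert q a⁻¹)) -
        (b / (1 - b ^ 2) + (oddLambert q b - oddLambert q b⁻¹)) =
      a * (qPochInf (b / a) q * qPochInf (q * a / b) q * qPochInf (-(a * b)) q *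
          qPochInf (-(q / (a * b))) q * (qPochInf (q ^ 2) (q ^ 2)) ^ 2 /
        (qPochInf (a ^ 2) (q ^ 2) * qPochInf (q ^ 2 / a ^ 2) (q ^ 2) *
          qPochInf (b ^ 2) (q ^ 2) * qPochInf (q ^ 2 / b ^ 2) (q ^ 2))) := by
  have hQ := norm_sq_lt_one hq
  have hna := one_sub_sq_ne_zero haq
  have hnb := one_sub_sq_ne_zero hbq
  rw [qPochInf_eq_one_sub_mul hq (b / a), qPochInf_eq_one_sub_mul hq (-(a * b)),
    qPochInf_eq_one_sub_mul hQ (a ^ 2), qPochInf_eq_one_sub_mul hQ (b ^ 2)]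
  rcases eq_or_ne q 0 with rfl | hq0
  · simp [oddLambert, qPochInf_zero]
    field_simp
    ring
  have h := theta_sub_of_ne_zero hq hq0 ha hb haq hbq
  rw [tsum_polarTerm hq hq0 ha hb haq hbq] at h
  have p1 := qPochInf_ne_zero hQ (sq_mul_sq_pow_ne_one haq)
  have p2 := qPochInf_ne_zero hQ (sq_div_sq_pow_ne_one ha haq)
  have p3 := qPochInf_ne_zero hQ (sq_mul_sq_pow_ne_one hbq)
  have p4 := qPochInf_ne_zero hQ (sq_div_sq_pow_ne_one hb hbq)
  have p5 := qPochInf_ne_zero hQ (self_mul_pow_ne_one hQ)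
  generalize qPochInf (b / a * q) q = x1 at h ⊢
  generalize qPochInf (q * a / b) q = x2 at h ⊢
  generalize qPochInf (-(a * b) * q) q = x3 at h ⊢
  generalize qPochInf (-(q / (a * b))) q = x4 at h ⊢
  generalize qPochInf (a ^ 2 * q ^ 2) (q ^ 2) = y1 at h p1 ⊢
  generalize qPochInf (q ^ 2 / a ^ 2) (q ^ 2) = y2 at h p2 ⊢
  generalize qPochInf (b ^ 2 * q ^ 2) (q ^ 2) = y3 at h p3 ⊢
  generalize qPochInf (q ^ 2 / b ^ 2) (q ^ 2) = y4 at h p4 ⊢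
  generalize qPochInf (q ^ 2) (q ^ 2) = y5 at h p5 ⊢
  have e1 : ∀ {c : ℂ}, c ≠ 0 → c - c⁻¹ = -(1 - c ^ 2) / c := fun hc => by
    field_simp
    ring
  have e2 : ∀ c : ℂ, c ≠ 0 → 1 - c ^ 2 ≠ 0 → 1 / (c - c⁻¹) = -(c / (1 - c ^ 2)) :=
    fun c hc hc' => by
      rw [e1 hc, one_div_div, div_neg]
  have e3 : a - a⁻¹ - (b - b⁻¹) = a * (1 - b / a) * (1 - -(a * b)) / (a * b) := by
    field_simp
    ring
  rw [e2 a ha hna, e2 b hb hnb, e3, e1 ha, e1 hb] at h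
  generalize oddLambert q a - oddLambert q a⁻¹ = La at h ⊢
  generalize oddLambert q b - oddLambert q b⁻¹ = Lb at h ⊢
  have h' : a / (1 - a ^ 2) + La - (b / (1 - b ^ 2) + Lb) =
      -(-(a / (1 - a ^ 2)) - -(b / (1 - b ^ 2)) - La + Lb) := by ring
  rw [h']
  generalize -(a / (1 - a ^ 2)) - -(b / (1 - b ^ 2)) - La + Lb = G at h ⊢
  generalize 1 - b / a = u1 at h ⊢
  generalize 1 - -(a * b) = u2 at h ⊢
  generalize 1 - a ^ 2 = u3 at h hna ⊢
  generalize 1 - b ^ 2 = u4 at h hnb ⊢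
  field_simp at h ⊢
  linear_combination h

end ThetaLimit

theorem theorem3 (q a b : ℂ) (hq : ‖q‖ < 1) (ha : a ≠ 0) (hb : b ≠ 0)
    (haq : ∀ n : ℤ, a ^ 2 * q ^ n ≠ 1) (hbq : ∀ n : ℤ, b ^ 2 * q ^ n ≠ 1)
    (α β : ℂ → ℂ → ℕ → ℂ) (αs βs : ℂ → ℕ → ℂ)
    (hpair : ∀ c ∈ ({a, -a, b, -b, 1 / a, -(1 / a), 1 / b, -(1 / b)} : Set ℂ),
      ∀ᶠ k in 𝓝[≠] (1 : ℂ), IsWPBaileyPair q c k (α c k) (β c k))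
    (hderived : ∀ c ∈ ({a, -a, b, -b, 1 / a, -(1 / a), 1 / b, -(1 / b)} : Set ℂ),
      IsDerivedPair α β c (αs c) (βs c))
    (hfa : F2Converges αs βs a q) (hfb : F2Converges αs βs b q)
    (hfa' : F2Converges αs βs (1 / a) q) (hfb' : F2Converges αs βs (1 / b) q) :
    f2 αs βs a q - f2 αs βs b q - f2 αs βs (1 / a) q + f2 αs βs (1 / b) q =
      2 * (a - b) * (1 + a * b) / ((1 - a ^ 2) * (1 - b ^ 2)) -
        2 * a *
          (qPochInf (b / a) q * qPochInf (q * a / b) q * qPochInf (-(a * b)) q *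
              qPochInf (-(q / (a * b))) q * (qPochInf (q ^ 2) (q ^ 2)) ^ 2 /
            (qPochInf (a ^ 2) (q ^ 2) * qPochInf (q ^ 2 / a ^ 2) (q ^ 2) *
              qPochInf (b ^ 2) (q ^ 2) * qPochInf (q ^ 2 / b ^ 2) (q ^ 2))) := by
  have hnat : ∀ {c : ℂ}, (∀ n : ℤ, c ^ 2 * q ^ n ≠ 1) → ∀ n : ℕ, c ^ 2 * q ^ n ≠ 1 :=
    fun h n => by simpa using h n
  have hinv : ∀ {c : ℂ}, c ≠ 0 → (∀ n : ℤ, c ^ 2 * q ^ n ≠ 1) →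
      ∀ n : ℕ, (1 / c) ^ 2 * q ^ n ≠ 1 := fun {c} hc h n h1 => by
    have h2 : q ^ n = c ^ 2 := by
      field_simp at h1
      exact h1
    refine h (-n) ?_
    rw [zpow_neg, zpow_natCast, h2, mul_inv_cancel₀ (pow_ne_zero 2 hc)]
  have ea : f2 αs βs a q = -2 * oddLambert q a := f2_eq hq ha (hnat haq)
    (fun c hc => hpair c (by rcases hc with rfl | rfl <;> simp))
    (fun c hc => hderived c (by rcases hc with rfl | rfl <;> simp)) hfa
  have eb : f2 αs βs b q = -2 * oddLambert q b := f2_eq hq hb (hnat hbq)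
    (fun c hc => hpair c (by rcases hc with rfl | rfl <;> simp))
    (fun c hc => hderived c (by rcases hc with rfl | rfl <;> simp)) hfb
  have ea' : f2 αs βs (1 / a) q = -2 * oddLambert q (1 / a) :=
    f2_eq hq (one_div_ne_zero ha) (hinv ha haq)
    (fun c hc => hpair c (by rcases hc with rfl | rfl <;> simp))
    (fun c hc => hderived c (by rcases hc with rfl | rfl <;> simp)) hfa'
  have eb' : f2 αs βs (1 / b) q = -2 * oddLambert q (1 / b) :=
    f2_eq hq (one_div_ne_zero hb) (hinv hb hbq)
    (fun c hc => hpair c (by rcases hc with rfl | rfl <;> simp))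
    (fun c hc => hderived c (by rcases hc with rfl | rfl <;> simp)) hfb'
  have h := lambert_sub_eq_theta hq ha hb haq hbq
  have hfrac : 2 * (a - b) * (1 + a * b) / ((1 - a ^ 2) * (1 - b ^ 2)) =
      2 * (a / (1 - a ^ 2)) - 2 * (b / (1 - b ^ 2)) := by
    have hna := one_sub_sq_ne_zero haq
    have hnb := one_sub_sq_ne_zero hbq
    field_simp
    ring
  rw [ea, eb, ea', eb', hfrac, mul_assoc 2 a, ← h, one_div, one_div]
  ring
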